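/- **Approximative Lemma.** Let $d\ge 1$, $s>d/2$, $T>0$, $u^0\in H^s(\mathbb T^d)$, where $\mathbb T^d=(\mathbb R/2\pi\mathbb Z)^d$ and $\|f\|_{H^s}^2=\sum_{k\in\mathbb Z^d}(1+|k|^2)^s|\hat f(k)|^2$. For a finite set $\mathcal K\subset\mathbb Z^d$ and controls $v=(v_k)_{k\in\mathcal K}$, $v_k\in L^1([0,T],\mathbb C)$, consider the defocusing cubic Schrödinger equation $$-i\partial_t u+\Delta u=|u|^2u+\sum_{k\in\mathcal K}v_k(t)\,e^{ik\cdot x},\qquad u|_{t=0}=u^0 .\qquad (1)$$ A mild solution of (1) on $[0,T]$ is a function $u\in C([0,T],H^s)$ with $$u(t)=e^{-it\Delta}\Big(u^0+i\int_0^t e^{i\tau\Delta}\Big(|u(\tau)|^2u(\tau)+\sum_{k\in\mathcal K}v_k(\tau)e^{ik\cdot x}\Big)d\tau\Big),\qquad t\in[0,T].$$ The end-point $E_T(v)$ is defined if (1) has a mild solution on $[0,T]$ and this solution is unique; then $E_T(v)=u(T)$. A finite set $\mathcal K'\subset\mathbb Z^d$ is an *elementary extension* of a finite set $\mathcal K$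 if $\mathcal K'=\mathcal K\cup\{2r-m\}$ for some $r,m\in\mathcal K$. It is a *proper extension* of $\mathcal K$ if there is a finite chain $\mathcal K=\mathcal K^1\subset\dots\subset\mathcal K^n=\mathcal K'$, $n\ge1$, in which each $\mathcal K^{j}$, $j\ge 2$, is an elementary extension of $\mathcal K^{j-1}$. Let $\mathcal K$ be a proper extension of the finite set $\hat{\mathcal K}\subset\mathbb Z^d$, let $B\subset\mathbb R^N$ be compact, and let $w(\cdot,b)=(w_k(\cdot,b))_{k\in\mathcal K}$, $b\in B$, be a family of controls in $L^1([0,T],\mathbb C)$ depending continuously on $b\in B$ in the $L^1$-metric, such that for each $b\in B$ equation (1) with the control $w(\cdot,b)$ has a mild solution on $[0,T]$. Let $X$ be a dense linear subspace of $L^1([0,T],\mathbb C)$ (for example $X=L^\infty$ or $X=L^1$). Then for each $\delta>0$ there is a family of controls $v(\cdot,b)=(v_k(\cdot,b))_{k\in\hat{\mathcal K}}$, $b\in B$, with $v_k(\cdot,b)\in X$, depending continuously on $b\in B$ in the $L^1$-metric, such that for every $b\in B$ the end-points $E_T(w(\cdot,b))$ and $E_T(v(\cdot,b))$ are defined and $$\|E_T(v(\cdot,b))-E_T(w(\cdot,b))\|_{H^s}\le\delta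 .$$ -/

import Mathlib

open MeasureTheory Set
open scoped ENNReal

noncomputable section

namespace TorusNLS

/-! ### The torus, its Fourier modes and its Sobolev spaces

A point of `𝕋^d = (ℝ/2πℤ)^d` is written `x = 2πθ` with `θ ∈ (ℝ/ℤ)^d`, so that the complex
exponential `e^{ik·x}` is the monomial `UnitAddTorus.mFourier k` in the variable `θ`, and
`Δ e^{ik·x} = -|k|² e^{ik·x}`. -/

/-- The torus `𝕋^d`. -/
abbrev Torus (d : ℕ) : Type := UnitAddTorus (Fin d)

/-- The normalised Haar measure of `𝕋^d`. -/
abbrev torusMeasure (d : ℕ) : Measure (Torus d) :=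
  Measure.pi fun _ : Fin d => (AddCircle.haarAddCircle : Measure UnitAddCircle)

/-- The Hilbert space `L²(𝕋^d)` of complex-valued functions. -/
abbrev L2Torus (d : ℕ) : Type := Lp ℂ 2 (torusMeasure d)

/-- The Hilbert basis `(e^{ik·x})` of `L²(𝕋^d)`. -/
def modeBasis (d : ℕ) : HilbertBasis (Fin d → ℤ) ℂ (L2Torus d) :=
  UnitAddTorus.mFourierBasis

/-- The `k`-th Fourier coefficient of `f ∈ L²(𝕋^d)`. -/
def fourierCoef {d : ℕ} (f : L2Torus d) (k : Fin d → ℤ) : ℂ :=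
  (modeBasis d).repr f k

/-- The Fourier coefficients are the usual integrals against the conjugate exponentials. -/
theorem fourierCoef_eq_integral {d : ℕ} (f : L2Torus d) (k : Fin d → ℤ) :
    fourierCoef f k = ∫ x, UnitAddTorus.mFourier (-k) x * f x ∂(torusMeasure d) :=
  UnitAddTorus.mFourierBasis_repr f k

/-- The squared Euclidean length `|k|²` of a frequency `k ∈ ℤ^d`. -/
def normSq {d : ℕ} (k : Fin d → ℤ) : ℝ := ∑ i, (k i : ℝ) ^ 2

theorem normSq_nonneg {d : ℕ} (k : Fin d → ℤ) : 0 ≤ normSq k :=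
  Finset.sum_nonneg fun _ _ => sq_nonneg _

/-- The Sobolev weight `(1 + |k|²)^{s/2}`. -/
def weight {d : ℕ} (s : ℝ) (k : Fin d → ℤ) : ℝ := (1 + normSq k) ^ (s / 2)

theorem weight_pos {d : ℕ} (s : ℝ) (k : Fin d → ℤ) : 0 < weight s k :=
  Real.rpow_pos_of_pos (by linarith [normSq_nonneg k]) _

/-- The functions `f ∈ L²(𝕋^d)` with `∑_k (1 + |k|²)^s |f̂(k)|² < ∞`. -/
def sobolevSubmodule (d : ℕ) (s : ℝ) : Submodule ℂ (L2Torus d) where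
  carrier := {f | Memℓp (fun k => (weight s k : ℂ) * fourierCoef f k) 2}
  zero_mem' := by
    simpa [fourierCoef] using (zero_mem_ℓp' : Memℓp (fun _ : Fin d → ℤ => (0 : ℂ)) 2)
  add_mem' := by
    intro f g hf hg
    have h := Memℓp.add hf hg
    simp only [mem_ofPred_eq]
    convert! h using 1
    funext k
    simp [fourierCoef, mul_add]
  smul_mem' := by
    intro c f hf
    have h := Memℓp.const_mul hf c
    simp only [mem_ofPred_eq]
    convert! h using 1
    funext k
    simp [fourierCoef]
    ring

/-- The Sobolev space `H^s(𝕋^d)`. -/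
def SobolevSpace (d : ℕ) (s : ℝ) : Type := sobolevSubmodule d s

namespace SobolevSpace

variable {d : ℕ} {s : ℝ}

instance : AddCommGroup (SobolevSpace d s) :=
  inferInstanceAs (AddCommGroup (sobolevSubmodule d s))

instance : Module ℂ (SobolevSpace d s) :=
  inferInstanceAs (Module ℂ (sobolevSubmodule d s))

/-- The inclusion `H^s(𝕋^d) ⊂ L²(𝕋^d)`. -/
def toL2 : SobolevSpace d s →ₗ[ℂ] L2Torus d := (sobolevSubmodule d s).subtype

theorem toL2_injective : Function.Injective (toL2 : SobolevSpace d s → L2Torus d) :=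
  Subtype.val_injective

theorem memℓp_weight (f : SobolevSpace d s) :
    Memℓp (fun k => (weight s k : ℂ) * fourierCoef (toL2 f) k) 2 :=
  f.2

/-- The element of `H^s(𝕋^d)` given by a function of `L²(𝕋^d)`. -/
def ofL2 (f : L2Torus d) (hf : f ∈ sobolevSubmodule d s) : SobolevSpace d s := ⟨f, hf⟩

/-- The map `f ↦ ((1 + |k|²)^{s/2} f̂(k))_k` from `H^s(𝕋^d)` to `ℓ²(ℤ^d)`. -/
def weightedCoef : SobolevSpace d s →ₗ[ℂ] lp (fun _ : Fin d → ℤ => ℂ) 2 where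
  toFun f := ⟨fun k => (weight s k : ℂ) * fourierCoef (toL2 f) k, memℓp_weight f⟩
  map_add' f g := by
    apply lp.ext
    funext k
    change _ = (weight s k : ℂ) * fourierCoef (toL2 f) k +
      (weight s k : ℂ) * fourierCoef (toL2 g) k
    simp [fourierCoef, mul_add]
  map_smul' c f := by
    apply lp.ext
    funext k
    change _ = c * ((weight s k : ℂ) * fourierCoef (toL2 f) k)
    simp [fourierCoef]
    ring

theorem weightedCoef_apply (f : SobolevSpace d s) (k : Fin d → ℤ) :
    weightedCoef f k = (weight s k : ℂ) * fourierCoef (toL2 f) k := rfl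

theorem weightedCoef_injective :
    Function.Injective (weightedCoef : SobolevSpace d s → lp (fun _ : Fin d → ℤ => ℂ) 2) := by
  intro f g h
  apply toL2_injective
  apply (modeBasis d).repr.injective
  apply lp.ext
  funext k
  have hk : weightedCoef f k = weightedCoef g k := by rw [h]
  rw [weightedCoef_apply, weightedCoef_apply] at hk
  exact mul_left_cancel₀ (by exact_mod_cast (weight_pos s k).ne') hk

/-- The norm `‖f‖_{H^s} = (∑_k (1 + |k|²)^s |f̂(k)|²)^{1/2}`. -/
instance : NormedAddCommGroup (SobolevSpace d s) :=
  NormedAddCommGroup.induced (SobolevSpace d s) (lp (fun _ : Fin d → ℤ => ℂ) 2)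
    weightedCoef weightedCoef_injective

instance : NormedSpace ℂ (SobolevSpace d s) :=
  NormedSpace.induced ℂ (SobolevSpace d s) (lp (fun _ : Fin d → ℤ => ℂ) 2) weightedCoef

theorem norm_sq_eq (f : SobolevSpace d s) :
    ‖f‖ ^ 2 = ∑' k : Fin d → ℤ, (1 + normSq k) ^ s * ‖fourierCoef (toL2 f) k‖ ^ 2 := by
  have h := lp.norm_rpow_eq_tsum (p := 2) (by norm_num) (weightedCoef f)
  have h2 : ‖weightedCoef f‖ = ‖f‖ := rfl
  norm_num at h
  rw [h2] at h
  rw [h]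
  congr 1
  funext k
  rw [weightedCoef_apply, norm_mul, mul_pow]
  congr 1
  have hk : 0 ≤ 1 + normSq k := by linarith [normSq_nonneg k]
  rw [Complex.norm_real, Real.norm_eq_abs, sq_abs, weight, ← Real.rpow_natCast,
    ← Real.rpow_mul hk]
  norm_num

/-- For `s ≥ 0` the map to `ℓ²(ℤ^d)` is onto, so that `H^s(𝕋^d)` is a Hilbert space and Bochner
integrals of `H^s`-valued functions have their usual meaning. -/
theorem weightedCoef_surjective (hs : 0 ≤ s) :
    Function.Surjective (weightedCoef : SobolevSpace d s → lp (fun _ : Fin d → ℤ => ℂ) 2) := by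
  intro a
  have hw : ∀ k : Fin d → ℤ, 1 ≤ weight s k := fun k =>
    Real.one_le_rpow (by linarith [normSq_nonneg k]) (by linarith)
  have hmem : Memℓp (fun k => (weight s k : ℂ)⁻¹ * a k) 2 := by
    have ha := lp.memℓp a
    rw [memℓp_gen_iff (by norm_num)] at ha ⊢
    refine Summable.of_nonneg_of_le (fun k => by positivity) (fun k => ?_) ha
    have h1 : ‖(weight s k : ℂ)⁻¹ * a k‖ ≤ ‖a k‖ := by
      rw [norm_mul, norm_inv, Complex.norm_real, Real.norm_eq_abs,
        abs_of_pos (weight_pos s k)]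
      exact mul_le_of_le_one_left (norm_nonneg _) (inv_le_one_of_one_le₀ (hw k))
    exact Real.rpow_le_rpow (norm_nonneg _) h1 (by norm_num)
  let g : lp (fun _ : Fin d → ℤ => ℂ) 2 := ⟨_, hmem⟩
  have hg : ∀ k, (weight s k : ℂ) * fourierCoef ((modeBasis d).repr.symm g) k = a k := by
    intro k
    have hk : (weight s k : ℂ) ≠ 0 := by exact_mod_cast (weight_pos s k).ne'
    simp only [fourierCoef, LinearIsometryEquiv.apply_symm_apply]
    change (weight s k : ℂ) * ((weight s k : ℂ)⁻¹ * a k) = a k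
    rw [mul_inv_cancel_left₀ hk]
  refine ⟨ofL2 ((modeBasis d).repr.symm g) ?_, ?_⟩
  · change Memℓp (fun k => (weight s k : ℂ) * fourierCoef ((modeBasis d).repr.symm g) k) 2
    simp only [hg]
    exact lp.memℓp a
  · apply lp.ext
    funext k
    exact hg k

theorem completeSpace (hs : 0 ≤ s) : CompleteSpace (SobolevSpace d s) := by
  let e : SobolevSpace d s ≃ᵢ lp (fun _ : Fin d → ℤ => ℂ) 2 :=
    { Equiv.ofBijective weightedCoef ⟨weightedCoef_injective, weightedCoef_surjective hs⟩ with
      isometry_toFun := AddMonoidHomClass.isometry_of_norm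
        (weightedCoef : SobolevSpace d s →ₗ[ℂ] lp (fun _ : Fin d → ℤ => ℂ) 2) fun _ => rfl }
  exact e.completeSpace

end SobolevSpace

/-! ### Modes and the free Schrödinger evolution on `H^s(𝕋^d)` -/

/-- The mode `e^{ik·x}` as an element of `H^s(𝕋^d)`. -/
def mode (d : ℕ) (s : ℝ) (k : Fin d → ℤ) : SobolevSpace d s :=
  SobolevSpace.ofL2 (modeBasis d k) <| by
    change Memℓp (fun j => (weight s j : ℂ) * fourierCoef (modeBasis d k) j) 2
    have h : ∀ j, fourierCoef (modeBasis d k) j = if j = k then 1 else 0 := by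
      intro j
      rw [fourierCoef, HilbertBasis.repr_self, lp.single_apply, Pi.single_apply]
    refine memℓp_gen (summable_of_ne_finset_zero (s := {k}) fun j hj => ?_)
    rw [Finset.mem_singleton] at hj
    simp [h, hj]

theorem mode_ae_eq (d : ℕ) (s : ℝ) (k : Fin d → ℤ) :
    (SobolevSpace.toL2 (mode d s k) : Torus d → ℂ) =ᵐ[torusMeasure d]
      UnitAddTorus.mFourier k := by
  have h : SobolevSpace.toL2 (mode d s k) = UnitAddTorus.mFourierLp 2 k :=
    congrFun UnitAddTorus.coe_mFourierBasis k
  rw [h]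
  exact UnitAddTorus.coeFn_mFourierLp 2 k

/-- The Fourier multiplier `e^{i|k|²t}` of `e^{-itΔ}`. -/
def phase {d : ℕ} (t : ℝ) (k : Fin d → ℤ) : ℂ := Complex.exp ((t * normSq k : ℝ) * Complex.I)

theorem norm_phase {d : ℕ} (t : ℝ) (k : Fin d → ℤ) : ‖phase t k‖ = 1 :=
  Complex.norm_exp_ofReal_mul_I _

theorem memℓp_phase_mul {d : ℕ} (t : ℝ) {a : (Fin d → ℤ) → ℂ} (ha : Memℓp a 2) :
    Memℓp (fun k => phase t k * a k) 2 := by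
  rw [← memℓp_norm_iff] at ha ⊢
  simpa [norm_phase] using ha

/-- The free evolution `e^{-itΔ}` on `L²(𝕋^d)`: the `k`-th Fourier coefficient is multiplied by
`e^{i|k|²t}`. -/
def freeEvolutionL2 {d : ℕ} (t : ℝ) (f : L2Torus d) : L2Torus d :=
  (modeBasis d).repr.symm
    ⟨fun k => phase t k * fourierCoef f k, memℓp_phase_mul t (lp.memℓp ((modeBasis d).repr f))⟩

theorem fourierCoef_freeEvolutionL2 {d : ℕ} (t : ℝ) (f : L2Torus d) (k : Fin d → ℤ) :
    fourierCoef (freeEvolutionL2 t f) k = phase t k * fourierCoef f k := by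
  simp only [fourierCoef, freeEvolutionL2, LinearIsometryEquiv.apply_symm_apply]

/-- The free evolution `e^{-itΔ}` on `H^s(𝕋^d)`, the solution group of `(-i∂_t + Δ)u = 0`. -/
def freeEvolution {d : ℕ} {s : ℝ} (t : ℝ) (f : SobolevSpace d s) : SobolevSpace d s :=
  SobolevSpace.ofL2 (freeEvolutionL2 t (SobolevSpace.toL2 f)) <| by
    change Memℓp (fun k => (weight s k : ℂ) *
      fourierCoef (freeEvolutionL2 t (SobolevSpace.toL2 f)) k) 2
    have h := memℓp_phase_mul t (SobolevSpace.memℓp_weight f)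
    convert! h using 1
    funext k
    rw [fourierCoef_freeEvolutionL2]
    ring

/-! ### Controls, mild solutions and end-points -/

/-- The space `L¹([0,T], ℂ)` of scalar controls. -/
abbrev L1Control (T : ℝ) : Type := Lp ℂ 1 ((volume : Measure ℝ).restrict (Icc 0 T))

/-- The source term `V(t) = ∑_{k ∈ K} v_k(t) e^{ik·x}`. -/
def sourceTerm {d : ℕ} (s : ℝ) {T : ℝ} {K : Finset (Fin d → ℤ)} (v : K → L1Control T) (t : ℝ) :
    SobolevSpace d s :=
  ∑ k : K, (v k : ℝ → ℂ) t • mode d s k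

/-- `u` is a mild solution on `[0,T]`, in `C([0,T], H^s)`, of
`-i∂_t u + Δu = |u|²u + ∑_{k ∈ K} v_k(t) e^{ik·x}`, `u(0) = u⁰`, that is
`u(t) = e^{-itΔ}(u⁰ + i ∫₀ᵗ e^{iτΔ}(|u|²u + V)(τ) dτ)`, where `G τ` is the cubic term
`|u(τ)|²u(τ)`, as an element of `H^s`. -/
def IsMildSolution {d : ℕ} {s T : ℝ} {K : Finset (Fin d → ℤ)} (u₀ : SobolevSpace d s)
    (v : K → L1Control T) (u : ℝ → SobolevSpace d s) : Prop :=
  ContinuousOn u (Icc 0 T) ∧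
  ∃ G : ℝ → SobolevSpace d s,
    (∀ τ ∈ Icc 0 T, ∀ᵐ x ∂(torusMeasure d),
      SobolevSpace.toL2 (G τ) x =
        (‖SobolevSpace.toL2 (u τ) x‖ ^ 2 : ℝ) * SobolevSpace.toL2 (u τ) x) ∧
    IntegrableOn (fun τ => freeEvolution (-τ) (G τ + sourceTerm s v τ)) (Icc 0 T) ∧
    ∀ t ∈ Icc 0 T,
      u t = freeEvolution t
        (u₀ + Complex.I • ∫ τ in (0 : ℝ)..t, freeEvolution (-τ) (G τ + sourceTerm s v τ))

/-- `z = E_T(v)`: the mild solution on `[0,T]` with initial value `u⁰` and control `v` exists, is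
unique, and takes the value `z` at time `T`. -/
def IsEndPoint {d : ℕ} {s T : ℝ} {K : Finset (Fin d → ℤ)} (u₀ : SobolevSpace d s)
    (v : K → L1Control T) (z : SobolevSpace d s) : Prop :=
  ∃ u, IsMildSolution u₀ v u ∧ (∀ u', IsMildSolution u₀ v u' → EqOn u' u (Icc 0 T)) ∧ u T = z

/-! ### Extensions of sets of modes -/

/-- `K'` is an elementary extension of `K`: `K' = K ∪ {2r - s}` for some `r, s ∈ K`. -/
def IsElementaryExtension {d : ℕ} (K K' : Finset (Fin d → ℤ)) : Prop :=
  ∃ r ∈ K, ∃ s ∈ K, K' = K ∪ {2 • r - s}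

/-- `K'` is a proper extension of `K`: it is reached from `K` by a finite chain
`K = K¹ ⊂ K² ⊂ ⋯ ⊂ Kᴺ = K'` of elementary extensions. -/
def IsProperExtension {d : ℕ} (K K' : Finset (Fin d → ℤ)) : Prop :=
  Relation.ReflTransGen IsElementaryExtension K K'

end TorusNLS

end

/-!
The theorem rests on a resonance of the cubic term. In the interaction picture
`α(t) = e^{itΔ} u(t)` the equation is an ordinary differential equation in `H^s`, driven by the
Duhamel term of the control. Since `s > d/2`, the space `H^s` is an algebra (`mulS`), so the cubic
term is a bounded trilinear map. Solutions are therefore unique (`IsMildSolution.eqOn`), and an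
approximate solution whose inhomogeneity is uniformly close to the Duhamel term of a control `v` is
followed by the solution for `v` (`exists_isEndPoint_near`). This stability only sees Duhamel
terms, so it also covers controls that are large but oscillate fast.

It suffices to eliminate one mode `2r - m` with `r, m ∈ K`. By density and stability the control of
this mode may be taken of the form `h³ q`, with `h = (t (T - t))²` and `q` continuously
differentiable in `t` (`exists_toControl_bump_approx`). Controls in the modes `r` and `m` can
superpose on a solution `y` the oscillating field

`e^{iωt} a₀ e^{ir·x} + e^{2iωt} a₁ e^{im·x} + e^{5iωt} a₂ e^{ir·x}`.

As `ω → ∞` only those products in the cubic term survive in the integrated equation whose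
frequencies cancel (`eventually_norm_integral_cubic_sub_le`). With the frequencies `0, 1, 2, 5`
these are the cubic term of `y`, the wanted term `a₀² ā₁ e^{i(2r - m)·x}`, and
`2 (|a₀|² + |a₁|² + |a₂|²) y` (`sum_resonant`). The last one only rotates the phase of `y`. It is
absorbed by replacing `y` and the slow controls by their multiples by `e^{iθ}` with
`θ' = 2 (|a₀|² + |a₁|² + |a₂|²)`, which the gauge invariance of the equation permits. The choice
`a₀ = h`, `a₁ = h q̄ e^{-iθ}` produces the control `h³ q e^{iθ}`, and the amplitude `a₂`, a constant
multiple of `h`, adjusts `θ(T)` to a multiple of `2π`, so that the end-point is unchanged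
(`exists_amplitudes`).

The estimates hold near each parameter uniformly in `ω`, so compactness of the parameter space gives
one frequency for all parameters (`exists_control_near_of_eq_bump`). The modes of a proper extension
are removed one after the other, and a final density argument places the controls in `X`.
-/

noncomputable section

namespace TorusNLS

open Filter Topology SobolevSpace

/-! ### Sobolev weights and absolutely convergent Fourier series -/

section Weights

variable {d : ℕ} {s : ℝ}

theorem summable_weight_inv_sq (hs : (d : ℝ) / 2 < s) :
    Summable fun k : Fin d → ℤ => ((weight s k)⁻¹) ^ 2 := by
  let b := Pi.basisFun ℝ (Fin d)
  let L : Submodule ℤ (Fin d → ℝ) := Submodule.span ℤ (range b)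
  have hrank : Module.finrank ℤ L = d := by
    rw [ZLattice.rank ℝ L]; simp
  have hmem : ∀ k : Fin d → ℤ, (fun i => (k i : ℝ)) ∈ L := fun k =>
    (b.mem_span_iff_repr_mem ℤ _).2 fun i => ⟨k i, by simp [b]⟩
  let φ : (Fin d → ℤ) → L := fun k => ⟨fun i => (k i : ℝ), hmem k⟩
  have hφ : Function.Injective φ := by
    intro k l h
    funext i
    have h1 : (k i : ℝ) = l i := congrFun (congrArg Subtype.val h) i
    exact_mod_cast h1
  have hsum := (ZLattice.summable_norm_rpow L (-(2 * s))
    (by rw [hrank]; linarith)).comp_injective hφ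
  refine hsum.of_norm_bounded_eventually ?_
  have h0 : ∀ᶠ k : Fin d → ℤ in cofinite, k ≠ 0 :=
    (finite_singleton (0 : Fin d → ℤ)).subset fun k hk => by simpa using hk
  filter_upwards [h0] with k hk
  have hpos : 0 < ‖φ k‖ := norm_pos_iff.2 fun h => hk (hφ (by rw [h]; ext; simp [φ]))
  have hle : ‖φ k‖ ^ 2 ≤ 1 + normSq k := by
    have h1 : ‖φ k‖ ≤ √(normSq k) := by
      change ‖fun i => (k i : ℝ)‖ ≤ _
      refine (pi_norm_le_iff_of_nonneg (Real.sqrt_nonneg _)).2 fun i => ?_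
      refine Real.le_sqrt_of_sq_le ?_
      rw [Real.norm_eq_abs, sq_abs]
      exact Finset.single_le_sum (f := fun i => (k i : ℝ) ^ 2) (fun _ _ => sq_nonneg _)
        (Finset.mem_univ i)
    calc ‖φ k‖ ^ 2 ≤ √(normSq k) ^ 2 := by gcongr
      _ = normSq k := Real.sq_sqrt (normSq_nonneg k)
      _ ≤ 1 + normSq k := by linarith
  have h1 : (0 : ℝ) ≤ 1 + normSq k := by linarith [normSq_nonneg k]
  have h2 : ((weight s k)⁻¹) ^ 2 = (1 + normSq k) ^ (-s) := by
    rw [weight, ← Real.rpow_neg h1, ← Real.rpow_natCast, ← Real.rpow_mul h1]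
    norm_num
  have hsn : -s ≤ 0 := by
    have : (0 : ℝ) ≤ d := Nat.cast_nonneg d
    linarith
  rw [h2, Real.norm_of_nonneg (Real.rpow_nonneg h1 _)]
  calc (1 + normSq k) ^ (-s) ≤ (‖φ k‖ ^ 2) ^ (-s) :=
        Real.rpow_le_rpow_of_nonpos (by positivity) hle hsn
    _ = ‖φ k‖ ^ (-(2 * s)) := by
        rw [← Real.rpow_natCast, ← Real.rpow_mul (norm_nonneg _)]
        norm_num

/-- The weights are subadditive up to a constant: one of `|j|`, `|l|` is at least `|j + l| / 2`. -/
theorem weight_add_le (hs : 0 ≤ s) (j l : Fin d → ℤ) :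
    weight s (j + l) ≤ 4 ^ (s / 2) * (weight s j + weight s l) := by
  have key : 1 + normSq (j + l) ≤ 4 * max (1 + normSq j) (1 + normSq l) := by
    have h : normSq (j + l) ≤ 2 * normSq j + 2 * normSq l := by
      simp only [normSq, Finset.mul_sum, ← Finset.sum_add_distrib]
      refine Finset.sum_le_sum fun i _ => ?_
      push_cast [Pi.add_apply]
      nlinarith [sq_nonneg ((j i : ℝ) - l i)]
    have := le_max_left (1 + normSq j) (1 + normSq l)
    have := le_max_right (1 + normSq j) (1 + normSq l)
    linarith
  have hj := normSq_nonneg j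
  have hl := normSq_nonneg l
  have hjl := normSq_nonneg (j + l)
  have hm : 0 ≤ max (1 + normSq j) (1 + normSq l) := le_max_of_le_left (by linarith)
  calc weight s (j + l) ≤ (4 * max (1 + normSq j) (1 + normSq l)) ^ (s / 2) :=
        Real.rpow_le_rpow (by linarith) key (by linarith)
    _ = 4 ^ (s / 2) * max (1 + normSq j) (1 + normSq l) ^ (s / 2) :=
        Real.mul_rpow (by norm_num) hm
    _ ≤ 4 ^ (s / 2) * (weight s j + weight s l) := by
        gcongr
        rcases max_cases (1 + normSq j) (1 + normSq l) with ⟨h, -⟩ | ⟨h, -⟩ <;> rw [h]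
        · exact le_add_of_nonneg_right (weight_pos s l).le
        · exact le_add_of_nonneg_left (weight_pos s j).le

/-- The sequence of inverse weights, as an element of `ℓ²`. -/
def invWeight (d : ℕ) (s : ℝ) [h : Fact ((d : ℝ) / 2 < s)] : lp (fun _ : Fin d → ℤ => ℝ) 2 :=
  ⟨fun k => (weight s k)⁻¹, memℓp_gen (by simpa using summable_weight_inv_sq h.out)⟩

theorem summable_norm_fourierCoef [Fact ((d : ℝ) / 2 < s)] (f : SobolevSpace d s) :
    (Summable fun k => ‖fourierCoef (SobolevSpace.toL2 f) k‖) ∧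
      ∑' k, ‖fourierCoef (SobolevSpace.toL2 f) k‖ ≤ ‖invWeight d s‖ * ‖f‖ := by
  let a : lp (fun _ : Fin d → ℤ => ℝ) 2 :=
    ⟨fun k => ‖SobolevSpace.weightedCoef f k‖, (lp.memℓp (SobolevSpace.weightedCoef f)).norm⟩
  have ha : ‖a‖ ≤ ‖f‖ := by
    refine (lp.norm_mono (y := SobolevSpace.weightedCoef f) (by norm_num) fun k => ?_)
    change ‖‖SobolevSpace.weightedCoef f k‖‖ ≤ _
    rw [norm_norm]
  have h := lp.tsum_mul_le_mul_norm (p := 2) (q := 2)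
    ⟨by norm_num, by norm_num, by norm_num⟩ (invWeight d s) a
  have e : ∀ k, ‖invWeight d s k‖ * ‖a k‖ = ‖fourierCoef (SobolevSpace.toL2 f) k‖ := by
    intro k
    have hk := weight_pos s k
    change ‖(weight s k)⁻¹‖ * ‖‖SobolevSpace.weightedCoef f k‖‖ = _
    rw [norm_norm, SobolevSpace.weightedCoef_apply, norm_mul, Complex.norm_real, norm_inv,
      inv_mul_cancel_left₀ (by simpa using hk.ne')]
  simp only [e] at h
  exact ⟨h.1, h.2.trans (by gcongr)⟩

end Weights

/-! ### Convolution of a summable with a square summable sequence -/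

/-- The translate `k ↦ b (k - j)` of a sequence in `ℓ²`. -/
def lpShift {G : Type*} [AddCommGroup G] (j : G) (b : lp (fun _ : G => ℝ) 2) :
    lp (fun _ : G => ℝ) 2 :=
  ⟨fun k => b (k - j), memℓp_gen <|
    ((lp.memℓp b).summable (by norm_num)).comp_injective (Equiv.subRight j).injective⟩

theorem norm_lpShift {G : Type*} [AddCommGroup G] (j : G) (b : lp (fun _ : G => ℝ) 2) :
    ‖lpShift j b‖ = ‖b‖ := by
  rw [lp.norm_eq_tsum_rpow (by norm_num), lp.norm_eq_tsum_rpow (by norm_num)]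
  congr 1
  exact (Equiv.subRight j).tsum_eq fun k => ‖b k‖ ^ (2 : ℝ≥0∞).toReal

/-- Young's inequality `‖a * b‖₂ ≤ ‖a‖₁ ‖b‖₂`: the convolution is an absolutely convergent sum of
translates of `b`. -/
theorem exists_lp_convolution {G : Type*} [AddCommGroup G] {a : G → ℝ} (ha : Summable a)
    (ha0 : ∀ j, 0 ≤ a j) (b : lp (fun _ : G => ℝ) 2) :
    ∃ c : lp (fun _ : G => ℝ) 2, (∀ k, HasSum (fun j => a j * b (k - j)) (c k)) ∧
      ‖c‖ ≤ (∑' j, a j) * ‖b‖ := by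
  have hn : ∀ j, ‖a j • lpShift j b‖ = a j * ‖b‖ := fun j => by
    rw [norm_smul, norm_lpShift, Real.norm_of_nonneg (ha0 j)]
  have hsum : Summable fun j => ‖a j • lpShift j b‖ := by
    simpa only [hn] using ha.mul_right ‖b‖
  refine ⟨∑' j, a j • lpShift j b, fun k => ?_, ?_⟩
  · exact (hsum.of_norm.hasSum).map (lp.evalCLM ℝ (fun _ : G => ℝ) 2 k)
      (ContinuousLinearMap.continuous _)
  · refine (norm_tsum_le_tsum_norm hsum).trans_eq ?_
    simp only [hn, tsum_mul_right]

/-! ### The algebra structure of `H^s(𝕋^d)` for `s > d/2` -/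

section Algebra

variable {d : ℕ} {s : ℝ}

theorem nonneg_of_fact [h : Fact ((d : ℝ) / 2 < s)] : 0 ≤ s := by
  have : (0 : ℝ) ≤ d := Nat.cast_nonneg d
  linarith [h.out]

instance [Fact ((d : ℝ) / 2 < s)] : CompleteSpace (SobolevSpace d s) :=
  SobolevSpace.completeSpace (nonneg_of_fact (d := d))

theorem norm_weightedCoef (f : SobolevSpace d s) : ‖weightedCoef f‖ = ‖f‖ := rfl

theorem SobolevSpace.ext_fourierCoef {f g : SobolevSpace d s}
    (h : ∀ k, fourierCoef (toL2 f) k = fourierCoef (toL2 g) k) : f = g := by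
  apply weightedCoef_injective
  apply lp.ext
  funext k
  rw [weightedCoef_apply, weightedCoef_apply, h]

@[simp] theorem fourierCoef_toL2_add (f g : SobolevSpace d s) (k : Fin d → ℤ) :
    fourierCoef (toL2 (f + g)) k = fourierCoef (toL2 f) k + fourierCoef (toL2 g) k := by
  simp [fourierCoef]

@[simp] theorem fourierCoef_toL2_smul (c : ℂ) (f : SobolevSpace d s) (k : Fin d → ℤ) :
    fourierCoef (toL2 (c • f)) k = c * fourierCoef (toL2 f) k := by
  simp [fourierCoef]

@[simp] theorem fourierCoef_mode (k j : Fin d → ℤ) :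
    fourierCoef (toL2 (mode d s k)) j = if j = k then 1 else 0 := by
  change fourierCoef (modeBasis d k) j = _
  rw [fourierCoef, HilbertBasis.repr_self, lp.single_apply, Pi.single_apply]

/-- A sequence `a` whose weighted sequence is dominated by an element of `ℓ²` is the sequence of
Fourier coefficients of an element of `H^s`. -/
theorem exists_fourierCoef_eq (hs : 0 ≤ s) (a : (Fin d → ℤ) → ℂ)
    (c : lp (fun _ : Fin d → ℤ => ℝ) 2) (h : ∀ k, weight s k * ‖a k‖ ≤ c k) :
    ∃ f : SobolevSpace d s, (∀ k, fourierCoef (toL2 f) k = a k) ∧ ‖f‖ ≤ ‖c‖ := by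
  have h1 : ∀ k, ‖(weight s k : ℂ) * a k‖ ≤ c k := fun k => by
    rw [norm_mul, Complex.norm_real, Real.norm_of_nonneg (weight_pos s k).le]
    exact h k
  let x : lp (fun _ : Fin d → ℤ => ℂ) 2 :=
    ⟨fun k => (weight s k : ℂ) * a k, (lp.memℓp c).mono h1⟩
  obtain ⟨f, hf⟩ := weightedCoef_surjective hs x
  refine ⟨f, fun k => ?_, ?_⟩
  · have hk : (weight s k : ℂ) * fourierCoef (toL2 f) k = (weight s k : ℂ) * a k := by
      rw [← weightedCoef_apply, hf]
    exact mul_left_cancel₀ (by exact_mod_cast (weight_pos s k).ne') hk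
  · rw [← norm_weightedCoef, hf]
    exact lp.norm_mono (by norm_num) fun k => (h1 k).trans (le_abs_self _)

/-- The change of variables `(k, j) ↦ (j, k - j)`. -/
def convEquiv {G : Type*} [AddCommGroup G] : G × G ≃ G × G where
  toFun p := (p.2, p.1 - p.2)
  invFun p := (p.1 + p.2, p.1)
  left_inv p := by simp
  right_inv p := by simp

variable [Fact ((d : ℝ) / 2 < s)]

theorem summable_norm_smul_mFourier (f : SobolevSpace d s) :
    Summable fun k => ‖fourierCoef (toL2 f) k • UnitAddTorus.mFourier k‖ := by
  simpa only [norm_smul, UnitAddTorus.mFourier_norm, mul_one] using (summable_norm_fourierCoef f).1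

/-- The embedding `H^s(𝕋^d) ⊂ C(𝕋^d)`, given by the absolutely convergent Fourier series. -/
def toCont : SobolevSpace d s →ₗ[ℂ] C(Torus d, ℂ) where
  toFun f := ∑' k, fourierCoef (toL2 f) k • UnitAddTorus.mFourier k
  map_add' f g := by
    rw [← (summable_norm_smul_mFourier f).of_norm.tsum_add
      (summable_norm_smul_mFourier g).of_norm]
    refine tsum_congr fun k => ?_
    rw [fourierCoef_toL2_add]
    exact add_smul (fourierCoef (toL2 f) k) (fourierCoef (toL2 g) k) (UnitAddTorus.mFourier k)
  map_smul' c f := by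
    rw [RingHom.id_apply, ← (summable_norm_smul_mFourier f).of_norm.tsum_const_smul]
    simp only [fourierCoef_toL2_smul, mul_smul]

theorem hasSum_toCont (f : SobolevSpace d s) :
    HasSum (fun k => fourierCoef (toL2 f) k • UnitAddTorus.mFourier k) (toCont f) :=
  (summable_norm_smul_mFourier f).of_norm.hasSum

theorem toLp_toCont (f : SobolevSpace d s) :
    ContinuousMap.toLp 2 (torusMeasure d) ℂ (toCont f) = toL2 f := by
  have h1 := (hasSum_toCont f).map (ContinuousMap.toLp (E := ℂ) 2 (torusMeasure d) ℂ)
    (ContinuousLinearMap.continuous _)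
  have h2 := (modeBasis d).hasSum_repr (toL2 f)
  refine h1.unique ?_
  convert! h2 using 1
  funext k
  simp only [Function.comp, map_smul]
  rw [modeBasis, UnitAddTorus.coe_mFourierBasis]
  rfl

theorem toCont_ae_eq (f : SobolevSpace d s) :
    (toL2 f : Torus d → ℂ) =ᵐ[torusMeasure d] toCont f := by
  rw [← toLp_toCont f]
  exact ContinuousMap.coeFn_toLp _ _

theorem toCont_injective : Function.Injective (toCont : SobolevSpace d s → C(Torus d, ℂ)) := by
  intro f g h
  apply toL2_injective
  rw [← toLp_toCont, ← toLp_toCont, h]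

-- Below, `toCont` enters only through `hasSum_toCont`, `toCont_ae_eq` and `toCont_injective`.
attribute [irreducible] toCont

/-- The constant in the product estimate `‖fg‖ ≤ C ‖f‖ ‖g‖`. -/
def mulConst (d : ℕ) (s : ℝ) [Fact ((d : ℝ) / 2 < s)] : ℝ :=
  2 * 4 ^ (s / 2) * ‖invWeight d s‖

theorem mulConst_nonneg : 0 ≤ mulConst d s := by unfold mulConst; positivity

theorem summable_convolution (f g : SobolevSpace d s) :
    Summable fun p : (Fin d → ℤ) × (Fin d → ℤ) =>
      ‖fourierCoef (toL2 f) p.2 * fourierCoef (toL2 g) (p.1 - p.2)‖ :=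
  (convEquiv.summable_iff (f := fun p : (Fin d → ℤ) × (Fin d → ℤ) =>
    ‖fourierCoef (toL2 f) p.1 * fourierCoef (toL2 g) p.2‖)).2
    ((summable_norm_fourierCoef f).1.mul_norm (summable_norm_fourierCoef g).1)

/-- The convolution `∑_j f̂(j) ĝ(k-j)` is the sequence of Fourier coefficients of an element of
`H^s`: distributing the weight of `k = j + (k-j)` over the two factors leaves two convolutions of a
summable with a square summable sequence. -/
theorem exists_fourierCoef_eq_convolution (f g : SobolevSpace d s) :
    ∃ h : SobolevSpace d s, (∀ k, fourierCoef (toL2 h) k =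
      ∑' j, fourierCoef (toL2 f) j * fourierCoef (toL2 g) (k - j)) ∧
      ‖h‖ ≤ mulConst d s * ‖f‖ * ‖g‖ := by
  let W : SobolevSpace d s → lp (fun _ : Fin d → ℤ => ℝ) 2 := fun f =>
    ⟨fun k => ‖weightedCoef f k‖, (lp.memℓp (weightedCoef f)).norm⟩
  have hWk : ∀ f k, W f k = weight s k * ‖fourierCoef (toL2 f) k‖ := fun f k => by
    change ‖weightedCoef f k‖ = _
    rw [weightedCoef_apply, norm_mul, Complex.norm_real, Real.norm_of_nonneg (weight_pos s k).le]
  have hWn : ∀ f, ‖W f‖ ≤ ‖f‖ := fun f =>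
    lp.norm_mono (y := weightedCoef f) (by norm_num) fun k => (norm_norm _).le
  obtain ⟨hf1, hf2⟩ := summable_norm_fourierCoef f
  obtain ⟨hg1, hg2⟩ := summable_norm_fourierCoef g
  obtain ⟨c₁, hc₁, hn₁⟩ := exists_lp_convolution hf1 (fun _ => norm_nonneg _) (W g)
  obtain ⟨c₂, hc₂, hn₂⟩ := exists_lp_convolution hg1 (fun _ => norm_nonneg _) (W f)
  have hbound : ∀ k, weight s k * ‖∑' j, fourierCoef (toL2 f) j * fourierCoef (toL2 g) (k - j)‖ ≤
      ((4 : ℝ) ^ (s / 2) • (c₁ + c₂)) k := by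
    intro k
    have hk := (summable_convolution f g).prod_factor k
    have hc₂' : HasSum (fun j => ‖fourierCoef (toL2 g) (k - j)‖ * W f j) (c₂ k) := by
      have := (Equiv.subLeft k).hasSum_iff.2 (hc₂ k)
      simpa [Function.comp_def] using this
    have hR := ((hc₁ k).add hc₂').mul_left ((4 : ℝ) ^ (s / 2))
    have hL := hk.hasSum.mul_left (weight s k)
    calc weight s k * ‖∑' j, fourierCoef (toL2 f) j * fourierCoef (toL2 g) (k - j)‖
        ≤ weight s k * ∑' j, ‖fourierCoef (toL2 f) j * fourierCoef (toL2 g) (k - j)‖ :=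
          mul_le_mul_of_nonneg_left (norm_tsum_le_tsum_norm hk) (weight_pos s k).le
      _ ≤ (4 : ℝ) ^ (s / 2) * (c₁ k + c₂ k) := by
          refine hasSum_le (fun j => ?_) hL hR
          have hw := weight_add_le (s := s) (nonneg_of_fact (d := d)) j (k - j)
          rw [add_sub_cancel] at hw
          rw [hWk, hWk, norm_mul]
          calc _ ≤ (4 ^ (s / 2) * (weight s j + weight s (k - j))) *
                (‖fourierCoef (toL2 f) j‖ * ‖fourierCoef (toL2 g) (k - j)‖) :=
                mul_le_mul_of_nonneg_right hw (by positivity)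
            _ = _ := by ring
  obtain ⟨h, hcoef, hnorm⟩ := exists_fourierCoef_eq (nonneg_of_fact (d := d)) _ _ hbound
  refine ⟨h, hcoef, hnorm.trans ?_⟩
  have b1 : ‖c₁‖ ≤ ‖invWeight d s‖ * ‖f‖ * ‖g‖ :=
    hn₁.trans (mul_le_mul hf2 (hWn g) (norm_nonneg _) (by positivity))
  have b2 : ‖c₂‖ ≤ ‖invWeight d s‖ * ‖g‖ * ‖f‖ :=
    hn₂.trans (mul_le_mul hg2 (hWn f) (norm_nonneg _) (by positivity))
  have h4 : (0 : ℝ) ≤ 4 ^ (s / 2) := by positivity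
  rw [norm_smul, Real.norm_of_nonneg h4]
  calc (4 : ℝ) ^ (s / 2) * ‖c₁ + c₂‖
      ≤ 4 ^ (s / 2) * (‖invWeight d s‖ * ‖f‖ * ‖g‖ + ‖invWeight d s‖ * ‖g‖ * ‖f‖) :=
        mul_le_mul_of_nonneg_left ((norm_add_le _ _).trans (add_le_add b1 b2)) h4
    _ = mulConst d s * ‖f‖ * ‖g‖ := by rw [mulConst]; ring

/-- The product of two elements of `H^s`, `s > d/2`, is in `H^s`. -/
theorem exists_toCont_mul (f g : SobolevSpace d s) :
    ∃ h : SobolevSpace d s, toCont h = toCont f * toCont g ∧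
      ‖h‖ ≤ mulConst d s * ‖f‖ * ‖g‖ := by
  obtain ⟨h, hcoef, hnorm⟩ := exists_fourierCoef_eq_convolution f g
  refine ⟨h, ?_, hnorm⟩
  have hmul := tsum_mul_tsum_of_summable_norm (summable_norm_smul_mFourier f)
    (summable_norm_smul_mFourier g)
  rw [(hasSum_toCont f).tsum_eq, (hasSum_toCont g).tsum_eq] at hmul
  rw [hmul, ← convEquiv.tsum_eq, Summable.tsum_prod, ← (hasSum_toCont h).tsum_eq]
  · refine tsum_congr fun k => ?_
    have hk := ((summable_convolution f g).prod_factor k).of_norm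
    have hsmul := hk.hasSum.smul_const (UnitAddTorus.mFourier k : C(Torus d, ℂ))
    rw [hcoef, ← hsmul.tsum_eq]
    refine tsum_congr fun j => ?_
    have he : (UnitAddTorus.mFourier k : C(Torus d, ℂ)) =
        UnitAddTorus.mFourier j * UnitAddTorus.mFourier (k - j) := by
      ext x
      rw [ContinuousMap.mul_apply, ← UnitAddTorus.mFourier_add, add_sub_cancel]
    rw [he]
    exact (smul_mul_smul_comm (fourierCoef (toL2 f) j) (UnitAddTorus.mFourier j)
      (fourierCoef (toL2 g) (k - j)) (UnitAddTorus.mFourier (k - j))).symm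
  · exact (summable_mul_of_summable_norm (summable_norm_smul_mFourier f)
      (summable_norm_smul_mFourier g)).comp_injective convEquiv.injective

theorem exists_toCont_star (f : SobolevSpace d s) :
    ∃ h : SobolevSpace d s, toCont h = star (toCont f) ∧ ‖h‖ ≤ 1 * ‖f‖ := by
  have hmem : Memℓp (fun k => ‖weightedCoef f (-k)‖) 2 := memℓp_gen <| by
    have h := ((lp.memℓp (weightedCoef f)).norm.summable (by norm_num)).comp_injective
      (Equiv.neg (Fin d → ℤ)).injective
    exact h
  let c : lp (fun _ : Fin d → ℤ => ℝ) 2 := ⟨_, hmem⟩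
  have hc : ‖c‖ = ‖f‖ := by
    rw [← norm_weightedCoef, lp.norm_eq_tsum_rpow (by norm_num), lp.norm_eq_tsum_rpow (by norm_num),
      ← (Equiv.neg (Fin d → ℤ)).tsum_eq]
    congr 1
    refine tsum_congr fun k => ?_
    have hk : c ((Equiv.neg (Fin d → ℤ)) k) = ‖weightedCoef f k‖ := by
      change ‖weightedCoef f (- -k)‖ = _
      rw [neg_neg]
    rw [hk, norm_norm]
  obtain ⟨h, hcoef, hnorm⟩ := exists_fourierCoef_eq (nonneg_of_fact (d := d) (s := s))
    (fun k => star (fourierCoef (toL2 f) (-k))) c fun k => by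
      change _ ≤ ‖weightedCoef f (-k)‖
      rw [weightedCoef_apply, norm_mul, Complex.norm_real,
        Real.norm_of_nonneg (weight_pos s _).le, norm_star]
      simp [weight, normSq]
  refine ⟨h, ?_, by rw [one_mul]; exact hnorm.trans_eq hc⟩
  rw [← (hasSum_toCont h).tsum_eq, ← (Equiv.neg _).tsum_eq, ← (hasSum_toCont f).star.tsum_eq]
  refine tsum_congr fun k => ?_
  ext x
  simp [hcoef, UnitAddTorus.mFourier_neg]

/-- The product of two elements of `H^s`. -/
def mulFun (f g : SobolevSpace d s) : SobolevSpace d s := (exists_toCont_mul f g).choose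

theorem toCont_mulFun (f g : SobolevSpace d s) : toCont (mulFun f g) = toCont f * toCont g :=
  (exists_toCont_mul f g).choose_spec.1

/-- Pointwise multiplication on `H^s`, `s > d/2`, as a bounded bilinear map. -/
def mulS : SobolevSpace d s →L[ℂ] SobolevSpace d s →L[ℂ] SobolevSpace d s :=
  LinearMap.mkContinuous₂
    (LinearMap.mk₂ ℂ mulFun
      (fun f f' g => toCont_injective <| by simp only [map_add, toCont_mulFun, add_mul])
      (fun c f g => toCont_injective <| by
        simp only [map_smul, toCont_mulFun]; exact smul_mul_assoc c (toCont f) (toCont g))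
      (fun f g g' => toCont_injective <| by simp only [map_add, toCont_mulFun, mul_add])
      (fun c f g => toCont_injective <| by
        simp only [map_smul, toCont_mulFun]; exact mul_smul_comm c (toCont f) (toCont g)))
    (mulConst d s) fun f g => (exists_toCont_mul f g).choose_spec.2

theorem toCont_mulS (f g : SobolevSpace d s) : toCont (mulS f g) = toCont f * toCont g :=
  toCont_mulFun f g

theorem norm_mulS_le (f g : SobolevSpace d s) : ‖mulS f g‖ ≤ mulConst d s * ‖f‖ * ‖g‖ :=
  (exists_toCont_mul f g).choose_spec.2

/-- The complex conjugate of an element of `H^s`. -/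
def conjFun (f : SobolevSpace d s) : SobolevSpace d s := (exists_toCont_star f).choose

theorem toCont_conjFun (f : SobolevSpace d s) : toCont (conjFun f) = star (toCont f) :=
  (exists_toCont_star f).choose_spec.1

/-- Complex conjugation on `H^s`. -/
def conjS : SobolevSpace d s →SL[starRingEnd ℂ] SobolevSpace d s :=
  LinearMap.mkContinuous
    { toFun := conjFun
      map_add' := fun f g => toCont_injective <| by simp only [map_add, toCont_conjFun, star_add]
      map_smul' := fun c f => toCont_injective <| by
        simp only [map_smul, toCont_conjFun]
        exact star_smul c (toCont f) }
    1 fun f => (exists_toCont_star f).choose_spec.2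

theorem toCont_conjS (f : SobolevSpace d s) : toCont (conjS f) = star (toCont f) :=
  toCont_conjFun f

theorem norm_conjS_le (f : SobolevSpace d s) : ‖conjS f‖ ≤ ‖f‖ := by
  rw [← one_mul ‖f‖]
  exact (exists_toCont_star f).choose_spec.2

-- The two maps are determined by `toCont_mulS` and `toCont_conjS`.
attribute [irreducible] mulS conjS

theorem toCont_mode (k : Fin d → ℤ) :
    toCont (mode d s k) = UnitAddTorus.mFourier k := by
  rw [← (hasSum_toCont (mode d s k)).tsum_eq, tsum_eq_single k]
  · simp
  · intro j hj
    rw [fourierCoef_mode, if_neg hj]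
    exact zero_smul ℂ (UnitAddTorus.mFourier j)

/-- The trilinear form `u v w̄` of the cubic nonlinearity. -/
def trilin (u v w : SobolevSpace d s) : SobolevSpace d s := mulS (mulS u v) (conjS w)

/-- The cubic nonlinearity `|u|² u`. -/
def cubic (u : SobolevSpace d s) : SobolevSpace d s := trilin u u u

theorem toCont_trilin (u v w : SobolevSpace d s) :
    toCont (trilin u v w) = toCont u * toCont v * star (toCont w) := by
  rw [trilin, toCont_mulS, toCont_mulS, toCont_conjS]

theorem continuous_trilin {Y : Type*} [TopologicalSpace Y] {u v w : Y → SobolevSpace d s}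
    (hu : Continuous u) (hv : Continuous v) (hw : Continuous w) :
    Continuous fun y => trilin (u y) (v y) (w y) :=
  (mulS.continuous.comp ((mulS.continuous.comp hu).clm_apply hv)).clm_apply
    (conjS.continuous.comp hw)

theorem continuous_cubic : Continuous (cubic : SobolevSpace d s → SobolevSpace d s) :=
  continuous_trilin continuous_id continuous_id continuous_id

theorem norm_trilin_le (u v w : SobolevSpace d s) :
    ‖trilin u v w‖ ≤ mulConst d s ^ 2 * (‖u‖ * ‖v‖ * ‖w‖) := by
  have hC := mulConst_nonneg (d := d) (s := s)
  calc ‖trilin u v w‖ ≤ mulConst d s * (mulConst d s * ‖u‖ * ‖v‖) * ‖w‖ := by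
        refine (norm_mulS_le _ _).trans ?_
        gcongr
        · exact norm_mulS_le u v
        · exact norm_conjS_le w
    _ = _ := by ring

theorem norm_cubic_sub_le {R : ℝ} {u v : SobolevSpace d s} (hu : ‖u‖ ≤ R)
    (hv : ‖v‖ ≤ R) : ‖cubic u - cubic v‖ ≤ 3 * mulConst d s ^ 2 * R ^ 2 * ‖u - v‖ := by
  have hR : 0 ≤ R := (norm_nonneg u).trans hu
  have e : cubic u - cubic v =
      trilin (u - v) u u + trilin v (u - v) u + trilin v v (u - v) := by
    apply toCont_injective
    simp only [cubic, map_add, map_sub, toCont_trilin, star_sub]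
    ring
  have h1 := norm_trilin_le (u - v) u u
  have h2 := norm_trilin_le v (u - v) u
  have h3 := norm_trilin_le v v (u - v)
  have b1 : ‖u - v‖ * ‖u‖ * ‖u‖ ≤ ‖u - v‖ * R * R := by gcongr
  have b2 : ‖v‖ * ‖u - v‖ * ‖u‖ ≤ R * ‖u - v‖ * R := by gcongr
  have b3 : ‖v‖ * ‖v‖ * ‖u - v‖ ≤ R * R * ‖u - v‖ := by gcongr
  have hC : 0 ≤ mulConst d s ^ 2 := sq_nonneg _
  rw [e]
  refine (norm_add₃_le).trans ?_
  nlinarith [mul_le_mul_of_nonneg_left b1 hC, mul_le_mul_of_nonneg_left b2 hC,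
    mul_le_mul_of_nonneg_left b3 hC]

/-- An element of `H^s` that is a.e. equal to `|u|² u` is the cubic nonlinearity of `u`. -/
theorem eq_cubic_iff (u g : SobolevSpace d s) :
    (∀ᵐ x ∂(torusMeasure d), toL2 g x = (‖toL2 u x‖ ^ 2 : ℝ) * toL2 u x) ↔ g = cubic u := by
  have key : ∀ z : ℂ, z * z * star z = (‖z‖ ^ 2 : ℝ) * z := by
    intro z
    rw [mul_assoc, mul_comm, Complex.star_def, Complex.mul_conj, Complex.normSq_eq_norm_sq]
  constructor
  · intro h
    apply toL2_injective
    apply Lp.ext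
    filter_upwards [h, toCont_ae_eq u, toCont_ae_eq (cubic u)] with x h1 h2 h3
    rw [h1, h3, h2, cubic, toCont_trilin]
    exact (key _).symm
  · rintro rfl
    filter_upwards [toCont_ae_eq u, toCont_ae_eq (cubic u)] with x h2 h3
    rw [h3, h2, cubic, toCont_trilin]
    exact key _

end Algebra

/-! ### The free evolution as a strongly continuous group of isometries -/

section Evolution

variable {d : ℕ} {s : ℝ}

theorem fourierCoef_freeEvolution (t : ℝ) (f : SobolevSpace d s) (k : Fin d → ℤ) :
    fourierCoef (toL2 (freeEvolution t f)) k = phase t k * fourierCoef (toL2 f) k :=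
  fourierCoef_freeEvolutionL2 t (toL2 f) k

theorem weightedCoef_freeEvolution (t : ℝ) (f : SobolevSpace d s) (k : Fin d → ℤ) :
    weightedCoef (freeEvolution t f) k = phase t k * weightedCoef f k := by
  rw [weightedCoef_apply, weightedCoef_apply, fourierCoef_freeEvolution]
  ring

theorem norm_sq_eq_tsum_weightedCoef (f : SobolevSpace d s) :
    ‖f‖ ^ 2 = ∑' k, ‖weightedCoef f k‖ ^ 2 := by
  have h := lp.norm_rpow_eq_tsum (p := 2) (by norm_num) (weightedCoef f)
  norm_num at h
  exact h

theorem summable_weightedCoef_sq (f : SobolevSpace d s) :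
    Summable fun k => ‖weightedCoef f k‖ ^ 2 := by
  simpa using (lp.memℓp (weightedCoef f)).summable (by norm_num)

/-- The free evolution `e^{-itΔ}` as a linear isometry of `H^s`. -/
def evol (t : ℝ) : SobolevSpace d s →ₗᵢ[ℂ] SobolevSpace d s where
  toFun := freeEvolution t
  map_add' f g := SobolevSpace.ext_fourierCoef fun k => by
    simp only [fourierCoef_freeEvolution, fourierCoef_toL2_add]
    ring
  map_smul' c f := SobolevSpace.ext_fourierCoef fun k => by
    simp only [fourierCoef_freeEvolution, fourierCoef_toL2_smul, RingHom.id_apply]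
    ring
  norm_map' f := by
    change ‖freeEvolution t f‖ = ‖f‖
    rw [← sq_eq_sq₀ (norm_nonneg _) (norm_nonneg _), norm_sq_eq_tsum_weightedCoef,
      norm_sq_eq_tsum_weightedCoef]
    simp only [weightedCoef_freeEvolution, norm_mul, norm_phase, one_mul]

theorem freeEvolution_eq_evol (t : ℝ) (f : SobolevSpace d s) : freeEvolution t f = evol t f := rfl

theorem weightedCoef_evol (t : ℝ) (f : SobolevSpace d s) (k : Fin d → ℤ) :
    weightedCoef (evol t f) k = phase t k * weightedCoef f k :=
  weightedCoef_freeEvolution t f k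

theorem fourierCoef_evol (t : ℝ) (f : SobolevSpace d s) (k : Fin d → ℤ) :
    fourierCoef (toL2 (evol t f)) k = phase t k * fourierCoef (toL2 f) k :=
  fourierCoef_freeEvolution t f k

attribute [irreducible] evol

theorem phase_add (t t' : ℝ) (k : Fin d → ℤ) : phase (t + t') k = phase t k * phase t' k := by
  rw [phase, phase, phase, ← Complex.exp_add]
  congr 1
  push_cast
  ring

theorem phase_zero (k : Fin d → ℤ) : phase 0 k = 1 := by simp [phase]

theorem continuous_phase (k : Fin d → ℤ) : Continuous fun t => phase t k := by
  unfold phase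
  fun_prop

theorem evol_evol_neg (t : ℝ) (f : SobolevSpace d s) : evol t (evol (-t) f) = f :=
  SobolevSpace.ext_fourierCoef fun k => by
    rw [fourierCoef_evol, fourierCoef_evol, ← mul_assoc, ← phase_add, add_neg_cancel, phase_zero,
      one_mul]

theorem evol_neg_evol (t : ℝ) (f : SobolevSpace d s) : evol (-t) (evol t f) = f := by
  simpa using evol_evol_neg (-t) f

theorem evol_mode (t : ℝ) (k : Fin d → ℤ) : evol t (mode d s k) = phase t k • mode d s k :=
  SobolevSpace.ext_fourierCoef fun j => by
    rw [fourierCoef_evol, fourierCoef_toL2_smul, fourierCoef_mode]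
    split_ifs with h
    · rw [h]
    · simp

theorem continuous_evol_apply (f : SobolevSpace d s) : Continuous fun t => evol t f := by
  rw [continuous_iff_continuousAt]
  intro t₀
  have key : Continuous fun t => ‖evol t f - evol t₀ f‖ ^ 2 := by
    have e : ∀ t k, ‖weightedCoef (evol t f - evol t₀ f) k‖ ^ 2 =
        ‖phase t k - phase t₀ k‖ ^ 2 * ‖weightedCoef f k‖ ^ 2 := fun t k => by
      rw [map_sub, lp.coeFn_sub, Pi.sub_apply, weightedCoef_evol,
        weightedCoef_evol, ← sub_mul, norm_mul, mul_pow]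
    simp only [norm_sq_eq_tsum_weightedCoef, e]
    refine continuous_tsum (u := fun k => 2 ^ 2 * ‖weightedCoef f k‖ ^ 2) (fun k => ?_)
      ((summable_weightedCoef_sq f).mul_left _) fun k t => ?_
    · exact (((continuous_phase k).sub continuous_const).norm.pow 2).mul continuous_const
    · rw [Real.norm_of_nonneg (by positivity)]
      gcongr
      refine (norm_sub_le _ _).trans ?_
      rw [norm_phase, norm_phase]
      norm_num
  rw [ContinuousAt, tendsto_iff_norm_sub_tendsto_zero]
  have h := (key.tendsto t₀).sqrt
  simpa [Real.sqrt_sq] using h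

theorem continuous_uncurry_evol :
    Continuous fun p : SobolevSpace d s × ℝ => evol p.2 p.1 :=
  continuous_prod_of_continuous_lipschitzWith _ 1 continuous_evol_apply
    fun t => (evol t).lipschitz

theorem continuous_evol {Y : Type*} [TopologicalSpace Y] {t : Y → ℝ} {f : Y → SobolevSpace d s}
    (ht : Continuous t) (hf : Continuous f) : Continuous fun y => evol (t y) (f y) :=
  continuous_uncurry_evol.comp (hf.prodMk ht)

theorem continuousOn_evol {Y : Type*} [TopologicalSpace Y] {S : Set Y} {t : Y → ℝ}
    {f : Y → SobolevSpace d s} (ht : ContinuousOn t S) (hf : ContinuousOn f S) :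
    ContinuousOn (fun y => evol (t y) (f y)) S :=
  continuous_uncurry_evol.comp_continuousOn (hf.prodMk ht)

/-! ### The equation in the interaction picture -/

theorem L1Control.integrableOn {T : ℝ} (f : L1Control T) : IntegrableOn f (Icc 0 T) :=
  memLp_one_iff_integrable.1 (Lp.memLp f)

theorem evol_sourceTerm {T : ℝ} {K : Finset (Fin d → ℤ)} (v : K → L1Control T) (τ t : ℝ) :
    evol τ (sourceTerm s v t) =
      ∑ k : K, ((v k : ℝ → ℂ) t * phase τ (k : Fin d → ℤ)) • mode d s k := by
  simp only [sourceTerm, map_sum, map_smul, evol_mode, smul_smul]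

theorem L1Control.integrableOn_mul_phase {T : ℝ} (f : L1Control T) (k : Fin d → ℤ) :
    IntegrableOn (fun τ => f τ * phase (-τ) k) (Icc 0 T) :=
  f.integrableOn.mul_bdd (c := 1)
    ((continuous_phase k).comp continuous_neg).aestronglyMeasurable
    (Eventually.of_forall fun τ => (norm_phase (-τ) k).le)

theorem integrableOn_evol_sourceTerm {T : ℝ} {K : Finset (Fin d → ℤ)} (v : K → L1Control T) :
    IntegrableOn (fun τ => evol (-τ) (sourceTerm s v τ)) (Icc 0 T) := by
  simp only [evol_sourceTerm]
  exact integrable_finsetSum _ fun k _ =>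
    ((v k).integrableOn_mul_phase (k : Fin d → ℤ)).smul_const _

theorem intervalIntegrable_of_integrableOn_Icc {E : Type*} [NormedAddCommGroup E] {f : ℝ → E}
    {T t : ℝ} (hf : IntegrableOn f (Icc 0 T)) (ht : t ∈ Icc 0 T) :
    IntervalIntegrable f volume 0 t :=
  (intervalIntegrable_iff_integrableOn_Icc_of_le ht.1).2
    (hf.mono_set (Icc_subset_Icc_right ht.2))

/-- The linear part `u⁰ + i ∫₀ᵗ e^{iτΔ} V(τ) dτ` of the Duhamel formula in the interaction
picture. -/
def duhamel {T : ℝ} {K : Finset (Fin d → ℤ)} (u₀ : SobolevSpace d s) (v : K → L1Control T)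
    (t : ℝ) : SobolevSpace d s :=
  u₀ + Complex.I • ∫ τ in (0 : ℝ)..t, evol (-τ) (sourceTerm s v τ)

theorem continuousOn_duhamel {T : ℝ} {K : Finset (Fin d → ℤ)} (hT : 0 ≤ T) (u₀ : SobolevSpace d s)
    (v : K → L1Control T) :
    ContinuousOn (duhamel u₀ v) (Icc 0 T) := by
  have h := intervalIntegral.continuousOn_primitive_interval (a := 0) (b := T) (μ := volume)
    (f := fun τ => evol (-τ) (sourceTerm s v τ))
    (by rw [uIcc_of_le hT]; exact integrableOn_evol_sourceTerm v)
  rw [uIcc_of_le hT] at h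
  exact continuousOn_const.add (h.const_smul Complex.I)

variable [Fact ((d : ℝ) / 2 < s)]

/-- The vector field of the equation in the interaction picture `a(t) = e^{itΔ}u(t)`. -/
def drift (τ : ℝ) (a : SobolevSpace d s) : SobolevSpace d s :=
  Complex.I • evol (-τ) (cubic (evol τ a))

theorem continuous_drift : Continuous fun p : ℝ × SobolevSpace d s => drift p.1 p.2 := by
  unfold drift
  exact (continuous_evol continuous_fst.neg
    (continuous_cubic.comp (continuous_evol continuous_fst continuous_snd))).const_smul Complex.I

theorem norm_drift_sub_le {R : ℝ} (τ : ℝ) {a b : SobolevSpace d s} (ha : ‖a‖ ≤ R) (hb : ‖b‖ ≤ R) :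
    ‖drift τ a - drift τ b‖ ≤ 3 * mulConst d s ^ 2 * R ^ 2 * ‖a - b‖ := by
  have h := norm_cubic_sub_le (u := evol τ a) (v := evol τ b)
    (((evol τ).norm_map a).trans_le ha) (((evol τ).norm_map b).trans_le hb)
  rw [← map_sub, (evol τ).norm_map] at h
  rw [drift, drift, ← smul_sub, ← map_sub, norm_smul, Complex.norm_I, one_mul,
    (evol (-τ)).norm_map]
  exact h

/-- In the interaction picture a mild solution solves an integral equation with a locally Lipschitz
vector field and the Duhamel term as inhomogeneity; the control enters through that term only. -/
theorem isMildSolution_iff {T : ℝ} {K : Finset (Fin d → ℤ)} (u₀ : SobolevSpace d s)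
    (v : K → L1Control T) (u : ℝ → SobolevSpace d s) :
    IsMildSolution u₀ v u ↔ ContinuousOn u (Icc 0 T) ∧ ∀ t ∈ Icc 0 T,
      evol (-t) (u t) = duhamel u₀ v t + ∫ τ in (0 : ℝ)..t, drift τ (evol (-τ) (u τ)) := by
  have hsrc := integrableOn_evol_sourceTerm (s := s) v
  have hcub : ContinuousOn u (Icc 0 T) →
      IntegrableOn (fun τ => evol (-τ) (cubic (u τ))) (Icc 0 T) := fun hu => by
    refine ContinuousOn.integrableOn_compact isCompact_Icc ?_
    exact continuousOn_evol continuousOn_id.neg (continuous_cubic.comp_continuousOn hu)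
  have hdrift : ∀ τ, drift τ (evol (-τ) (u τ)) = Complex.I • evol (-τ) (cubic (u τ)) := fun τ => by
    rw [drift, evol_evol_neg]
  have hsplit : ContinuousOn u (Icc 0 T) → ∀ t ∈ Icc 0 T,
      u₀ + Complex.I • ∫ τ in (0 : ℝ)..t, evol (-τ) (cubic (u τ) + sourceTerm s v τ) =
        duhamel u₀ v t + ∫ τ in (0 : ℝ)..t, drift τ (evol (-τ) (u τ)) := by
    intro hu t ht
    simp only [hdrift, map_add]
    rw [intervalIntegral.integral_add (intervalIntegrable_of_integrableOn_Icc (hcub hu) ht)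
      (intervalIntegrable_of_integrableOn_Icc hsrc ht), intervalIntegral.integral_smul, duhamel,
      smul_add]
    abel
  constructor
  · rintro ⟨hu, G, hG, -, hsol⟩
    refine ⟨hu, fun t ht => ?_⟩
    rw [hsol t ht, freeEvolution_eq_evol, evol_neg_evol, ← hsplit hu t ht]
    congr 2
    refine intervalIntegral.integral_congr fun τ hτ => ?_
    rw [uIcc_of_le ht.1] at hτ
    have hτ' : τ ∈ Icc 0 T := ⟨hτ.1, hτ.2.trans ht.2⟩
    rw [freeEvolution_eq_evol, (eq_cubic_iff (u τ) (G τ)).1 (hG τ hτ')]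
  · rintro ⟨hu, hsol⟩
    refine ⟨hu, fun τ => cubic (u τ), fun τ _ => (eq_cubic_iff _ _).2 rfl, ?_, fun t ht => ?_⟩
    · simp only [freeEvolution_eq_evol, map_add]
      exact (hcub hu).add hsrc
    · simp only [freeEvolution_eq_evol]
      rw [hsplit hu t ht, ← hsol t ht, evol_evol_neg]

end Evolution

/-! ### Integral equations with a locally Lipschitz vector field -/

section IntegralEquation

variable {E : Type*} [NormedAddCommGroup E] [NormedSpace ℝ E]

/-- The radial retraction of a normed space onto the closed ball of radius `R`. -/
def radialRetraction (R : ℝ) (x : E) : E := (R / max R ‖x‖) • x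

theorem radialRetraction_of_norm_le {R : ℝ} (hR : 0 < R) {x : E} (hx : ‖x‖ ≤ R) :
    radialRetraction R x = x := by
  rw [radialRetraction, max_eq_left hx, div_self hR.ne', one_smul]

theorem norm_radialRetraction_le {R : ℝ} (hR : 0 < R) (x : E) : ‖radialRetraction R x‖ ≤ R := by
  have hm : 0 < max R ‖x‖ := lt_max_of_lt_left hR
  rw [radialRetraction, norm_smul, Real.norm_of_nonneg (by positivity), div_mul_eq_mul_div,
    div_le_iff₀ hm]
  gcongr
  exact le_max_right _ _

theorem norm_radialRetraction_sub_le {R : ℝ} (hR : 0 < R) (x y : E) :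
    ‖radialRetraction R x - radialRetraction R y‖ ≤ 2 * ‖x - y‖ := by
  have hx : 0 < max R ‖x‖ := lt_max_of_lt_left hR
  have hy : 0 < max R ‖y‖ := lt_max_of_lt_left hR
  have e : radialRetraction R x - radialRetraction R y =
      (R / max R ‖x‖) • (x - y) + (R / max R ‖x‖ - R / max R ‖y‖) • y := by
    simp only [radialRetraction]
    module
  have h1 : ‖(R / max R ‖x‖) • (x - y)‖ ≤ ‖x - y‖ := by
    rw [norm_smul, Real.norm_of_nonneg (by positivity)]
    refine mul_le_of_le_one_left (norm_nonneg _) ?_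
    rw [div_le_one hx]
    exact le_max_left _ _
  have h2 : ‖(R / max R ‖x‖ - R / max R ‖y‖) • y‖ ≤ ‖x - y‖ := by
    have hd : |max R ‖y‖ - max R ‖x‖| ≤ ‖x - y‖ := by
      refine (abs_max_sub_max_le_abs _ _ R |>.trans_eq' ?_).trans
        ((abs_norm_sub_norm_le y x).trans_eq (norm_sub_rev y x))
      rw [max_comm R, max_comm R]
    have e2 : R / max R ‖x‖ - R / max R ‖y‖ =
        (R / max R ‖x‖) * ((max R ‖y‖ - max R ‖x‖) / max R ‖y‖) := by
      field_simp
    have b1 : R / max R ‖x‖ ≤ 1 := (div_le_one hx).2 (le_max_left _ _)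
    rw [norm_smul, e2, norm_mul, Real.norm_of_nonneg (by positivity : 0 ≤ R / max R ‖x‖),
      norm_div, Real.norm_of_nonneg hy.le, Real.norm_eq_abs]
    calc R / max R ‖x‖ * (|max R ‖y‖ - max R ‖x‖| / max R ‖y‖) * ‖y‖
        ≤ 1 * (|max R ‖y‖ - max R ‖x‖| / max R ‖y‖) * max R ‖y‖ := by
          gcongr
          exact le_max_right _ _
      _ = |max R ‖y‖ - max R ‖x‖| := by field_simp
      _ ≤ ‖x - y‖ := hd
  rw [e]
  linarith [norm_add_le ((R / max R ‖x‖) • (x - y)) ((R / max R ‖x‖ - R / max R ‖y‖) • y)]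

theorem continuousOn_integral {f : ℝ → E} {T : ℝ} (hf : ContinuousOn f (Icc 0 T)) :
    ContinuousOn (fun t => ∫ τ in (0 : ℝ)..t, f τ) (Icc 0 T) := by
  rcases le_or_gt 0 T with hT | hT
  · have h := intervalIntegral.continuousOn_primitive_interval (f := f) (a := 0) (b := T)
      (μ := volume) (by rw [uIcc_of_le hT]; exact hf.integrableOn_Icc)
    rwa [uIcc_of_le hT] at h
  · simp [Icc_eq_empty_of_lt hT]

/-- A time-dependent vector field that is Lipschitz on balls, uniformly in time. -/
structure IsLocallyLipschitzField (N : ℝ → E → E) : Prop where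
  continuous : Continuous fun p : ℝ × E => N p.1 p.2
  lipschitz : ∀ R : ℝ, ∃ L : ℝ, 0 < L ∧ ∀ t a b, ‖a‖ ≤ R → ‖b‖ ≤ R →
    ‖N t a - N t b‖ ≤ L * ‖a - b‖

variable [CompleteSpace E]

theorem hasDerivWithinAt_integral_Ici {f : ℝ → E} {T t : ℝ} (hf : ContinuousOn f (Icc 0 T))
    (ht : t ∈ Ico 0 T) :
    HasDerivWithinAt (fun t => ∫ τ in (0 : ℝ)..t, f τ) (f t) (Ici t) t := by
  have hT : 0 ≤ T := ht.1.trans ht.2.le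
  let F : ℝ → E := IccExtend hT (Icc 0 T |>.domRestrict f)
  have hF : Continuous F := hf.domRestrict.Icc_extend'
  have hFf : EqOn F f (Icc 0 T) := fun τ hτ => IccExtend_of_mem hT _ hτ
  have h1 : HasDerivWithinAt (fun t => ∫ τ in (0 : ℝ)..t, F τ) (F t) (Ici t) t :=
    (hF.integral_hasStrictDerivAt 0 t).hasDerivAt.hasDerivWithinAt
  rw [hFf ⟨ht.1, ht.2.le⟩] at h1
  refine h1.congr_of_eventuallyEq_of_mem ?_ self_mem_Ici
  filter_upwards [Icc_mem_nhdsGE_of_mem ⟨le_rfl, ht.2⟩] with r hr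
  refine intervalIntegral.integral_congr fun τ hτ => ?_
  rw [uIcc_of_le (ht.1.trans hr.1)] at hτ
  exact (hFf ⟨hτ.1, hτ.2.trans hr.2⟩).symm

/-- Two continuous solutions of `α(t) = g(t) + ∫₀ᵗ N(τ, α(τ)) dτ` coincide. -/
theorem IsLocallyLipschitzField.eqOn_of_integral_eq {N : ℝ → E → E}
    (hN : IsLocallyLipschitzField N) {T : ℝ} {α β g : ℝ → E} (hα : ContinuousOn α (Icc 0 T))
    (hβ : ContinuousOn β (Icc 0 T))
    (hα' : ∀ t ∈ Icc 0 T, α t = g t + ∫ τ in (0 : ℝ)..t, N τ (α τ))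
    (hβ' : ∀ t ∈ Icc 0 T, β t = g t + ∫ τ in (0 : ℝ)..t, N τ (β τ)) :
    EqOn α β (Icc 0 T) := by
  obtain ⟨Rα, hRα⟩ := isCompact_Icc.exists_bound_of_continuousOn hα
  obtain ⟨Rβ, hRβ⟩ := isCompact_Icc.exists_bound_of_continuousOn hβ
  obtain ⟨L, hL, hLip⟩ := hN.lipschitz (max Rα Rβ)
  have hc : ∀ {γ : ℝ → E}, ContinuousOn γ (Icc 0 T) →
      ContinuousOn (fun t => N t (γ t)) (Icc 0 T) := fun hγ =>
    hN.continuous.comp_continuousOn (continuousOn_id.prodMk hγ)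
  have hv : ∀ t ∈ Ico 0 T, LipschitzOnWith ⟨L, hL.le⟩ (fun x => N t (x + g t))
      {x | ‖x + g t‖ ≤ max Rα Rβ} := fun t _ =>
    LipschitzOnWith.of_dist_le_mul fun x hx y hy => by
      rw [dist_eq_norm, dist_eq_norm, ← add_sub_add_right_eq_sub x y (g t)]
      exact hLip t _ _ hx hy
  have key : ∀ {γ : ℝ → E}, (∀ t ∈ Icc 0 T, γ t = g t + ∫ τ in (0 : ℝ)..t, N τ (γ τ)) →
      ∀ t ∈ Icc 0 T, (∫ τ in (0 : ℝ)..t, N τ (γ τ)) + g t = γ t := fun h t ht => by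
    rw [h t ht, add_comm]
  have hder : ∀ {γ : ℝ → E}, ContinuousOn γ (Icc 0 T) →
      (∀ t ∈ Icc 0 T, γ t = g t + ∫ τ in (0 : ℝ)..t, N τ (γ τ)) → ∀ t ∈ Ico 0 T,
      HasDerivWithinAt (fun t => ∫ τ in (0 : ℝ)..t, N τ (γ τ))
        (N t ((∫ τ in (0 : ℝ)..t, N τ (γ τ)) + g t)) (Ici t) t := fun hγ h t ht => by
    rw [key h t (Ico_subset_Icc_self ht)]
    exact hasDerivWithinAt_integral_Ici (hc hγ) ht
  -- The integral terms solve the differential equation `x' = N(t, x + g)`, although `α` and `β`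
  -- need not be differentiable.
  have huniq := ODE_solution_unique_of_mem_Icc_right hv (continuousOn_integral (hc hα))
    (hder hα hα') (fun t ht => by
      change ‖_ + g t‖ ≤ _
      rw [key hα' t (Ico_subset_Icc_self ht)]
      exact (hRα t (Ico_subset_Icc_self ht)).trans (le_max_left _ _))
    (continuousOn_integral (hc hβ)) (hder hβ hβ') (fun t ht => by
      change ‖_ + g t‖ ≤ _
      rw [key hβ' t (Ico_subset_Icc_self ht)]
      exact (hRβ t (Ico_subset_Icc_self ht)).trans (le_max_right _ _)) (by simp)
  intro t ht
  rw [hα' t ht, hβ' t ht]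
  congr 1
  exact huniq ht

/-- For a globally Lipschitz and bounded vector field the integral equation
`α(t) = g(t) + ∫₀ᵗ N(τ, α(τ)) dτ` has a solution on the whole interval. The unknown is the integral
`x = α - g`, which is differentiable even though `g` is only continuous. -/
theorem exists_integral_eq_of_bounded {N : ℝ → E → E}
    (hc : Continuous fun p : ℝ × E => N p.1 p.2) {K : NNReal} (hK : ∀ t, LipschitzWith K (N t))
    {T : ℝ} (hT : 0 ≤ T) {M : ℝ} (hM : ∀ t ∈ Icc 0 T, ∀ x, ‖N t x‖ ≤ M) {g : ℝ → E}
    (hg : ContinuousOn g (Icc 0 T)) :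
    ∃ x : ℝ → E, ContinuousOn x (Icc 0 T) ∧ x 0 = 0 ∧
      ∀ t ∈ Icc 0 T, HasDerivWithinAt x (N t (x t + g t)) (Icc 0 T) t := by
  have hM0 : 0 ≤ M := (norm_nonneg _).trans (hM 0 ⟨le_rfl, hT⟩ 0)
  have hPL : IsPicardLindelof (fun t x => N t (x + g t)) (⟨0, le_rfl, hT⟩ : Icc 0 T) (0 : E)
      (⟨M, hM0⟩ * ⟨T, hT⟩) 0 ⟨M, hM0⟩ K :=
    { lipschitzOnWith := fun t _ => by
        refine LipschitzWith.lipschitzOnWith (LipschitzWith.of_dist_le_mul fun x y => ?_)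
        simpa using (hK t).dist_le_mul (x + g t) (y + g t)
      continuousOn := fun x _ =>
        hc.comp_continuousOn (continuousOn_id.prodMk (continuousOn_const.add hg))
      norm_le := fun t ht x _ => hM t ht _
      mul_max_le := by
        simp only [sub_zero, sub_self, max_eq_left hT, NNReal.coe_zero]
        exact le_rfl }
  obtain ⟨x, hx0, hx⟩ := hPL.exists_eq_forall_mem_Icc_hasDerivWithinAt₀
  exact ⟨x, fun t ht => (hx t ht).continuousWithinAt, hx0, hx⟩

/-- Shadowing: near a bounded solution `a` of the integral equation with inhomogeneity `g₁` there is
a solution `b` for every inhomogeneity `g₂` close to `g₁`. The vector field is truncated outside a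
ball to have a solution on the whole interval, and Grönwall's inequality keeps that solution in the
ball; the admissible size of `g₂ - g₁` depends only on the bound for `a`. -/
theorem IsLocallyLipschitzField.exists_near {N : ℝ → E → E} (hN : IsLocallyLipschitzField N)
    {T : ℝ} (hT : 0 ≤ T) (R : ℝ) {ε : ℝ} (hε : 0 < ε) :
    ∃ η : ℝ, 0 < η ∧ ∀ a g₁ g₂ : ℝ → E, ContinuousOn a (Icc 0 T) → ContinuousOn g₂ (Icc 0 T) →
      (∀ t ∈ Icc 0 T, ‖a t‖ ≤ R) → (∀ t ∈ Icc 0 T, a t = g₁ t + ∫ τ in (0 : ℝ)..t, N τ (a τ)) →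
      (∀ t ∈ Icc 0 T, ‖g₂ t - g₁ t‖ ≤ η) →
      ∃ b : ℝ → E, ContinuousOn b (Icc 0 T) ∧
        (∀ t ∈ Icc 0 T, b t = g₂ t + ∫ τ in (0 : ℝ)..t, N τ (b τ)) ∧
        ∀ t ∈ Icc 0 T, ‖b t - a t‖ ≤ ε := by
  let R₁ := |R| + ε
  have hR₁ : 0 < R₁ := by positivity
  obtain ⟨L, hL, hLip⟩ := hN.lipschitz R₁
  let η := ε * Real.exp (-(2 * L * T))
  have hη : 0 < η := by positivity
  refine ⟨η, hη, fun a g₁ g₂ ha hg₂ haR hae hgg => ?_⟩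
  let NR : ℝ → E → E := fun t x => N t (radialRetraction R₁ x)
  have hNR : ∀ t x, ‖x‖ ≤ R₁ → NR t x = N t x := fun t x hx => by
    simp only [NR, radialRetraction_of_norm_le hR₁ hx]
  let K : NNReal := ⟨2 * L, by positivity⟩
  have hNRK : ∀ t, LipschitzWith K (NR t) := fun t => LipschitzWith.of_dist_le_mul fun x y => by
    rw [dist_eq_norm, dist_eq_norm]
    refine (hLip t _ _ (norm_radialRetraction_le hR₁ x) (norm_radialRetraction_le hR₁ y)).trans ?_
    refine (mul_le_mul_of_nonneg_left (norm_radialRetraction_sub_le hR₁ x y) hL.le).trans_eq ?_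
    change _ = 2 * L * ‖x - y‖
    ring
  have hretr : Continuous (radialRetraction R₁ : E → E) := by
    refine (LipschitzWith.of_dist_le_mul (K := 2) fun x y => ?_).continuous
    rw [dist_eq_norm, dist_eq_norm]
    exact norm_radialRetraction_sub_le hR₁ x y
  have hNRc : Continuous fun p : ℝ × E => NR p.1 p.2 :=
    hN.continuous.comp (continuous_fst.prodMk (hretr.comp continuous_snd))
  have hN0 : Continuous fun t => N t 0 :=
    hN.continuous.comp (continuous_id.prodMk continuous_const)
  obtain ⟨M, hM⟩ := (isCompact_Icc (a := (0 : ℝ)) (b := T)).exists_bound_of_continuousOn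
    hN0.continuousOn
  have hNRM : ∀ t ∈ Icc 0 T, ∀ x, ‖NR t x‖ ≤ M + L * R₁ := fun t ht x => by
    have h1 := hLip t (radialRetraction R₁ x) 0 (norm_radialRetraction_le hR₁ x)
      (by simpa using hR₁.le)
    have h2 := norm_le_norm_add_norm_sub (N t 0) (NR t x)
    have h3 : L * ‖radialRetraction R₁ x - 0‖ ≤ L * R₁ := by
      rw [sub_zero]
      exact mul_le_mul_of_nonneg_left (norm_radialRetraction_le hR₁ x) hL.le
    rw [norm_sub_rev] at h2
    linarith [hM t ht]
  obtain ⟨x, hxc, hx0, hx⟩ := exists_integral_eq_of_bounded hNRc hNRK hT hNRM hg₂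
  have haR₁ : ∀ t ∈ Icc 0 T, ‖a t‖ ≤ R₁ := fun t ht =>
    (haR t ht).trans ((le_abs_self R).trans (by simp only [R₁]; linarith))
  have hac : ContinuousOn (fun t => N t (a t)) (Icc 0 T) :=
    hN.continuous.comp_continuousOn (continuousOn_id.prodMk ha)
  have hxr : ∀ t ∈ Ico 0 T, HasDerivWithinAt x (NR t (x t + g₂ t)) (Ici t) t := fun t ht =>
    (hx t (Ico_subset_Icc_self ht)).mono_of_mem_nhdsWithin (Icc_mem_nhdsGE_of_mem ht)
  -- `x` is an exact and `a - g₁` an approximate trajectory of the same vector field.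
  have hgron := dist_le_of_approx_trajectories_ODE (v := fun t y => NR t (y + g₂ t)) (K := K)
    (δ := 0) (εf := 0) (εg := 2 * L * η)
    (fun t => LipschitzWith.of_dist_le_mul fun y z => by
      simpa using (hNRK t).dist_le_mul (y + g₂ t) (z + g₂ t))
    hxc hxr (fun t _ => (dist_self _).le) (continuousOn_integral hac)
    (fun t ht => hasDerivWithinAt_integral_Ici hac ht)
    (fun t ht => by
      have ht' := Ico_subset_Icc_self ht
      rw [← hNR t _ (haR₁ t ht')]
      refine ((hNRK t).dist_le_mul _ _).trans ?_
      refine mul_le_mul_of_nonneg_left ?_ (by positivity : (0 : ℝ) ≤ 2 * L)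
      rw [dist_comm, dist_eq_norm, hae t ht', add_comm (g₁ t), add_sub_add_left_eq_sub]
      exact hgg t ht')
    (by simp [hx0])
  have hclose : ∀ t ∈ Icc 0 T, ‖x t + g₂ t - a t‖ ≤ ε := fun t ht => by
    have h1 := hgron t ht
    have hKL : (K : ℝ) = 2 * L := rfl
    rw [hKL, gronwallBound_of_K_ne_0 (by positivity : (2 * L : ℝ) ≠ 0)] at h1
    have e1 : 0 * Real.exp (2 * L * (t - 0)) +
        (0 + 2 * L * η) / (2 * L) * (Real.exp (2 * L * (t - 0)) - 1) =
        η * Real.exp (2 * L * t) - η := by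
      rw [sub_zero]
      field_simp
      ring
    have e2 : x t + g₂ t - a t = (x t - ∫ τ in (0 : ℝ)..t, N τ (a τ)) + (g₂ t - g₁ t) := by
      rw [hae t ht]
      abel
    have e3 : η * Real.exp (2 * L * t) ≤ ε := by
      rw [mul_assoc, ← Real.exp_add]
      refine mul_le_of_le_one_right hε.le (Real.exp_le_one_iff.2 ?_)
      nlinarith [ht.2]
    beta_reduce at h1
    rw [e1, dist_eq_norm] at h1
    rw [e2]
    linarith [norm_add_le (x t - ∫ τ in (0 : ℝ)..t, N τ (a τ)) (g₂ t - g₁ t), hgg t ht]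
  have hxR₁ : ∀ t ∈ Icc 0 T, ‖x t + g₂ t‖ ≤ R₁ := fun t ht => by
    have h1 := norm_le_norm_add_norm_sub (a t) (x t + g₂ t)
    rw [norm_sub_rev] at h1
    have h2 := hclose t ht
    have h3 := (haR t ht).trans (le_abs_self R)
    simp only [R₁]
    linarith
  refine ⟨fun t => x t + g₂ t, hxc.add hg₂, fun t ht => ?_, hclose⟩
  have hsub : Icc 0 t ⊆ Icc 0 T := Icc_subset_Icc_right ht.2
  have hbc : ContinuousOn (fun τ => N τ (x τ + g₂ τ)) (Icc 0 T) :=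
    hN.continuous.comp_continuousOn (continuousOn_id.prodMk (hxc.add hg₂))
  have hint := intervalIntegral.integral_eq_sub_of_hasDeriv_right_of_le ht.1 (hxc.mono hsub)
    (fun τ hτ => by
      have hτ' : τ ∈ Ico 0 T := ⟨hτ.1.le, hτ.2.trans_le ht.2⟩
      have h := hxr τ hτ'
      rw [hNR τ _ (hxR₁ τ (Ico_subset_Icc_self hτ'))] at h
      exact h.mono Ioi_subset_Ici_self)
    ((intervalIntegrable_iff_integrableOn_Icc_of_le ht.1).2 (hbc.mono hsub).integrableOn_Icc)
  change x t + g₂ t = _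
  rw [hint, hx0, sub_zero, add_comm]

end IntegralEquation

/-! ### Stability of the end-point -/

section Stability

variable {d : ℕ} {s : ℝ} [Fact ((d : ℝ) / 2 < s)] {T : ℝ} {K : Finset (Fin d → ℤ)}

theorem isLocallyLipschitzField_drift :
    IsLocallyLipschitzField (drift : ℝ → SobolevSpace d s → SobolevSpace d s) where
  continuous := continuous_drift
  lipschitz R := ⟨3 * mulConst d s ^ 2 * R ^ 2 + 1, by positivity, fun t a b ha hb =>
    (norm_drift_sub_le t ha hb).trans <| by
      gcongr
      exact le_add_of_nonneg_right zero_le_one⟩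

theorem IsMildSolution.eqOn {u₀ : SobolevSpace d s} {v : K → L1Control T}
    {u u' : ℝ → SobolevSpace d s} (h : IsMildSolution u₀ v u) (h' : IsMildSolution u₀ v u') :
    EqOn u' u (Icc 0 T) := by
  rw [isMildSolution_iff] at h h'
  have hc : ∀ {w : ℝ → SobolevSpace d s}, ContinuousOn w (Icc 0 T) →
      ContinuousOn (fun t => evol (-t) (w t)) (Icc 0 T) := fun hw =>
    continuousOn_evol continuousOn_id.neg hw
  intro t ht
  exact (evol (-t)).injective
    (isLocallyLipschitzField_drift.eqOn_of_integral_eq (hc h'.1) (hc h.1) h'.2 h.2 ht)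

theorem IsMildSolution.isEndPoint {u₀ : SobolevSpace d s} {v : K → L1Control T}
    {u : ℝ → SobolevSpace d s} (h : IsMildSolution u₀ v u) : IsEndPoint u₀ v (u T) :=
  ⟨u, h, fun _ h' => h.eqOn h', rfl⟩

theorem IsEndPoint.unique (hT : 0 ≤ T) {u₀ : SobolevSpace d s} {v : K → L1Control T}
    {y z : SobolevSpace d s} (hy : IsEndPoint u₀ v y) (hz : IsEndPoint u₀ v z) : y = z := by
  obtain ⟨u, hu, -, rfl⟩ := hy
  obtain ⟨u', hu', -, rfl⟩ := hz
  exact hu'.eqOn hu ⟨hT, le_rfl⟩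

/-- A bounded curve solving the integral equation for an inhomogeneity `g` is followed by the mild
solution of every control whose Duhamel term is uniformly close to `g`. -/
theorem exists_isEndPoint_near (hT : 0 ≤ T) (R : ℝ) {ε : ℝ} (hε : 0 < ε) :
    ∃ η : ℝ, 0 < η ∧ ∀ (K : Finset (Fin d → ℤ)) (u₀ : SobolevSpace d s) (v : K → L1Control T)
      (a g : ℝ → SobolevSpace d s), ContinuousOn a (Icc 0 T) → (∀ t ∈ Icc 0 T, ‖a t‖ ≤ R) →
      (∀ t ∈ Icc 0 T, a t = g t + ∫ τ in (0 : ℝ)..t, drift τ (a τ)) →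
      (∀ t ∈ Icc 0 T, ‖duhamel u₀ v t - g t‖ ≤ η) →
      ∃ z, IsEndPoint u₀ v z ∧ ‖z - evol T (a T)‖ ≤ ε := by
  obtain ⟨η, hη, h⟩ := (isLocallyLipschitzField_drift (d := d) (s := s)).exists_near hT R hε
  refine ⟨η, hη, fun K u₀ v a g ha haR hae hg => ?_⟩
  obtain ⟨b, hb, hbe, hba⟩ := h a g (duhamel u₀ v) ha (continuousOn_duhamel hT u₀ v) haR hae hg
  have hmild : IsMildSolution u₀ v fun t => evol t (b t) := by
    rw [isMildSolution_iff]
    refine ⟨continuousOn_evol continuousOn_id hb, fun t ht => ?_⟩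
    simp only [evol_neg_evol]
    exact hbe t ht
  refine ⟨_, hmild.isEndPoint, ?_⟩
  rw [← map_sub, (evol T).norm_map]
  exact hba T ⟨hT, le_rfl⟩

theorem norm_duhamel_sub_le (u₀ : SobolevSpace d s) (v w : K → L1Control T) {t : ℝ}
    (ht : t ∈ Icc 0 T) :
    ‖duhamel u₀ v t - duhamel u₀ w t‖ ≤ ∑ k : K, ‖v k - w k‖ * ‖mode d s (k : Fin d → ℤ)‖ := by
  have e1 : duhamel u₀ v t - duhamel u₀ w t = Complex.I •
      ∑ k : K, (∫ τ in (0 : ℝ)..t, ((v k : ℝ → ℂ) τ - w k τ) * phase (-τ) (k : Fin d → ℤ)) •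
        mode d s (k : Fin d → ℤ) := by
    rw [duhamel, duhamel, add_sub_add_left_eq_sub, ← smul_sub,
      ← intervalIntegral.integral_sub
        (intervalIntegrable_of_integrableOn_Icc (integrableOn_evol_sourceTerm v) ht)
        (intervalIntegrable_of_integrableOn_Icc (integrableOn_evol_sourceTerm w) ht)]
    congr 1
    simp only [evol_sourceTerm, ← Finset.sum_sub_distrib, ← sub_smul, ← sub_mul]
    rw [intervalIntegral.integral_finsetSum]
    · refine Finset.sum_congr rfl fun k _ => ?_
      rw [intervalIntegral.integral_smul_const]
    · intro k _
      simp only [sub_mul]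
      have h := (intervalIntegrable_of_integrableOn_Icc ((v k).integrableOn_mul_phase
        (k : Fin d → ℤ)) ht).sub
        (intervalIntegrable_of_integrableOn_Icc ((w k).integrableOn_mul_phase (k : Fin d → ℤ)) ht)
      exact ⟨h.1.smul_const _, h.2.smul_const _⟩
  rw [e1, norm_smul, Complex.norm_I, one_mul]
  refine (norm_sum_le _ _).trans (Finset.sum_le_sum fun k _ => ?_)
  rw [norm_smul]
  gcongr
  rw [L1.norm_eq_integral_norm]
  have hint : IntegrableOn (fun τ => ‖(v k - w k : L1Control T) τ‖) (Icc 0 T) :=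
    (v k - w k).integrableOn.norm
  calc ‖∫ τ in (0 : ℝ)..t, ((v k : ℝ → ℂ) τ - w k τ) * phase (-τ) (k : Fin d → ℤ)‖
      ≤ ∫ τ in Ioc 0 t, ‖((v k : ℝ → ℂ) τ - w k τ) * phase (-τ) (k : Fin d → ℤ)‖ := by
        rw [intervalIntegral.integral_of_le ht.1]
        exact norm_integral_le_integral_norm _
    _ = ∫ τ in Ioc 0 t, ‖(v k - w k : L1Control T) τ‖ := by
        refine setIntegral_congr_ae measurableSet_Ioc ?_
        have h := (ae_restrict_iff' measurableSet_Icc).1 (Lp.coeFn_sub (v k) (w k))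
        filter_upwards [h] with τ hτ hmem
        rw [hτ ⟨hmem.1.le, hmem.2.trans ht.2⟩, norm_mul, norm_phase, mul_one, Pi.sub_apply]
    _ ≤ ∫ τ in Icc 0 T, ‖(v k - w k : L1Control T) τ‖ :=
        setIntegral_mono_set hint (Eventually.of_forall fun _ => norm_nonneg _)
          (LE.le.eventuallyLE fun τ hτ => ⟨hτ.1.le, hτ.2.trans ht.2⟩)

/-- The end-point depends continuously on the control in the `L¹` metric; in particular it is
defined for all controls close to one with a mild solution. -/
theorem IsMildSolution.exists_isEndPoint_near (hT : 0 ≤ T) {u₀ : SobolevSpace d s}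
    {w : K → L1Control T} {u : ℝ → SobolevSpace d s} (hu : IsMildSolution u₀ w u) {ε : ℝ}
    (hε : 0 < ε) : ∃ η : ℝ, 0 < η ∧ ∀ v : K → L1Control T, (∀ k, ‖v k - w k‖ ≤ η) →
      ∃ z, IsEndPoint u₀ v z ∧ ‖z - u T‖ ≤ ε := by
  rw [isMildSolution_iff] at hu
  have hc : ContinuousOn (fun t => evol (-t) (u t)) (Icc 0 T) :=
    continuousOn_evol continuousOn_id.neg hu.1
  obtain ⟨R, hR⟩ := isCompact_Icc.exists_bound_of_continuousOn hc
  obtain ⟨η, hη, h⟩ := TorusNLS.exists_isEndPoint_near (d := d) (s := s) hT R hε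
  let C := ∑ k : K, ‖mode d s (k : Fin d → ℤ)‖
  have hC : 0 ≤ C := Finset.sum_nonneg fun _ _ => norm_nonneg _
  refine ⟨η / (C + 1), by positivity, fun v hv => ?_⟩
  obtain ⟨z, hz, hzu⟩ := h K u₀ v _ _ hc hR hu.2 fun t ht => by
    refine (norm_duhamel_sub_le u₀ v w ht).trans ?_
    calc ∑ k : K, ‖v k - w k‖ * ‖mode d s (k : Fin d → ℤ)‖
        ≤ ∑ k : K, η / (C + 1) * ‖mode d s (k : Fin d → ℤ)‖ := by
          gcongr with k _
          exact hv k
      _ = η * (C / (C + 1)) := by rw [← Finset.mul_sum]; simp only [C]; ring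
      _ ≤ η := mul_le_of_le_one_right hη.le ((div_le_one (by positivity)).2 (by linarith))
  rw [evol_evol_neg] at hzu
  exact ⟨z, hz, hzu⟩

variable {P : Type*} [TopologicalSpace P] [CompactSpace P]

theorem exists_forall_isEndPoint_near (hT : 0 ≤ T) {u₀ : SobolevSpace d s}
    {w : P → K → L1Control T} (hw : ∀ k, Continuous fun b => w b k)
    (hsol : ∀ b, ∃ u, IsMildSolution u₀ (w b) u) {ε : ℝ} (hε : 0 < ε) :
    ∃ η : ℝ, 0 < η ∧ ∀ b, ∀ v : K → L1Control T, (∀ k, ‖v k - w b k‖ ≤ η) →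
      ∃ y z, IsEndPoint u₀ (w b) y ∧ IsEndPoint u₀ v z ∧ ‖z - y‖ ≤ ε := by
  have key : ∃ η : ℝ, 0 < η ∧ ∀ b ∈ (univ : Set P), ∀ v : K → L1Control T,
      (∀ k, ‖v k - w b k‖ ≤ η) →
      ∃ y z, IsEndPoint u₀ (w b) y ∧ IsEndPoint u₀ v z ∧ ‖z - y‖ ≤ ε := by
    refine isCompact_univ.induction_on (p := fun S : Set P => ∃ η : ℝ, 0 < η ∧ ∀ b ∈ S,
      ∀ v : K → L1Control T, (∀ k, ‖v k - w b k‖ ≤ η) →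
      ∃ y z, IsEndPoint u₀ (w b) y ∧ IsEndPoint u₀ v z ∧ ‖z - y‖ ≤ ε) ⟨1, one_pos, by simp⟩
      ?_ ?_ ?_
    · rintro S S' hS ⟨η, hη, h⟩
      exact ⟨η, hη, fun b hb => h b (hS hb)⟩
    · rintro S S' ⟨η, hη, h⟩ ⟨η', hη', h'⟩
      refine ⟨min η η', lt_min hη hη', fun b hb v hv => ?_⟩
      rcases hb with hb | hb
      · exact h b hb v fun k => (hv k).trans (min_le_left _ _)
      · exact h' b hb v fun k => (hv k).trans (min_le_right _ _)
    · intro b₀ _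
      obtain ⟨u, hu⟩ := hsol b₀
      obtain ⟨η, hη, h⟩ := hu.exists_isEndPoint_near hT (half_pos hε)
      have hU : ∀ᶠ b in 𝓝 b₀, ∀ k, ‖w b k - w b₀ k‖ < η / 2 := by
        refine eventually_all.2 fun k => ?_
        have h1 : ContinuousAt (fun b => ‖w b k - w b₀ k‖) b₀ :=
          ((hw k).sub continuous_const).norm.continuousAt
        exact h1.eventually_lt_const (by simpa using half_pos hη)
      refine ⟨_, mem_nhdsWithin_of_mem_nhds hU, η / 2, half_pos hη, fun b hb v hv => ?_⟩
      obtain ⟨y, hy, hyu⟩ := h (w b) fun k => ((hb k).trans (half_lt_self hη)).le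
      obtain ⟨z, hz, hzu⟩ := h v fun k => by
        have h1 := norm_add_le (v k - w b k) (w b k - w b₀ k)
        rw [sub_add_sub_cancel] at h1
        linarith [hb k, hv k]
      refine ⟨y, z, hy, hz, ?_⟩
      have h1 := norm_sub_le (z - u T) (y - u T)
      rw [sub_sub_sub_cancel_right] at h1
      linarith
  obtain ⟨η, hη, h⟩ := key
  exact ⟨η, hη, fun b => h b (mem_univ b)⟩

end Stability

/-- A continuous map from a compact space is uniformly approximated by finite combinations of
elements of a dense set with continuous coefficients. -/
theorem exists_finset_sum_approx {P E : Type*} [TopologicalSpace P] [CompactSpace P]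
    [NormedAddCommGroup E] [NormedSpace ℂ E] {f : P → E} (hf : Continuous f) {X : Set E}
    (hX : Dense X) {ε : ℝ} (hε : 0 < ε) :
    ∃ (F : Finset E) (φ : E → P → ℝ), ↑F ⊆ X ∧ (∀ x, Continuous (φ x)) ∧
      ∀ b, ‖∑ x ∈ F, (φ x b : ℂ) • x - f b‖ ≤ ε := by
  obtain ⟨F₀, hF₀X, hF₀, hcov⟩ := isCompact_univ.elim_finite_subcover_image (b := X)
    (c := fun x => {b | ‖x - f b‖ < ε})
    (fun x _ => isOpen_lt (continuous_const.sub hf).norm continuous_const) fun b _ => by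
      obtain ⟨x, hx, hxb⟩ := hX.exists_dist_lt (f b) hε
      rw [dist_comm, dist_eq_norm] at hxb
      exact mem_iUnion₂.2 ⟨x, hx, hxb⟩
  lift F₀ to Finset E using hF₀
  let l : E → P → ℝ := fun x b => max 0 (ε - ‖x - f b‖)
  have hl0 : ∀ x b, 0 ≤ l x b := fun x b => le_max_left _ _
  have hlc : ∀ x, Continuous (l x) := fun x =>
    continuous_const.max (continuous_const.sub (continuous_const.sub hf).norm)
  have hpos : ∀ b, 0 < ∑ x ∈ F₀, l x b := fun b => by
    obtain ⟨x, hx, hxb⟩ := mem_iUnion₂.1 (hcov (mem_univ b))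
    exact Finset.sum_pos' (fun x _ => hl0 x b) ⟨x, hx, lt_max_of_lt_right (sub_pos.2 hxb)⟩
  refine ⟨F₀, fun x b => l x b / ∑ y ∈ F₀, l y b, hF₀X, fun x => ?_, fun b => ?_⟩
  · exact (hlc x).div (continuous_finsetSum _ fun y _ => hlc y) fun b => (hpos b).ne'
  · have hsum : ∑ x ∈ F₀, l x b / ∑ y ∈ F₀, l y b = 1 := by
      rw [← Finset.sum_div, div_self (hpos b).ne']
    have e : ∑ x ∈ F₀, ((l x b / ∑ y ∈ F₀, l y b : ℝ) : ℂ) • x - f b =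
        ∑ x ∈ F₀, ((l x b / ∑ y ∈ F₀, l y b : ℝ) : ℂ) • (x - f b) := by
      simp only [smul_sub, Finset.sum_sub_distrib, ← Finset.sum_smul, ← Complex.ofReal_sum, hsum,
        Complex.ofReal_one, one_smul]
    rw [e]
    calc _ ≤ ∑ x ∈ F₀, (l x b / ∑ y ∈ F₀, l y b) * ε := by
          refine norm_sum_le_of_le _ fun x _ => ?_
          have hq : 0 ≤ l x b / ∑ y ∈ F₀, l y b := div_nonneg (hl0 x b) (hpos b).le
          rw [norm_smul, Complex.norm_real, Real.norm_of_nonneg hq]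
          rcases le_or_gt ‖x - f b‖ ε with hx | hx
          · gcongr
          · have : l x b = 0 := max_eq_left (by linarith)
            simp [this]
      _ = ε := by rw [← Finset.sum_mul, hsum, one_mul]

/-! ### Averaging of oscillating integrals -/

theorem continuous_exp_ofReal_mul_I (ν : ℝ) :
    Continuous fun τ : ℝ => Complex.exp ((ν * τ : ℝ) * Complex.I) := by
  fun_prop

/-- The Riemann–Lebesgue lemma, uniformly on the intervals `[0, t]`. A shift by half a period
changes the sign of the exponential, so that the modulus of continuity of `p` controls the
integral. -/
theorem eventually_norm_integral_exp_smul_le {E : Type*} [NormedAddCommGroup E] [NormedSpace ℂ E]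
    {p : ℝ → E} (hp : Continuous p) (T : ℝ) {n : ℤ} (hn : n ≠ 0) {ε : ℝ} (hε : 0 < ε) :
    ∀ᶠ ω : ℝ in atTop, ∀ t ∈ Icc 0 T,
      ‖∫ τ in (0 : ℝ)..t, Complex.exp ((n * ω * τ : ℝ) * Complex.I) • p τ‖ ≤ ε := by
  rcases lt_or_ge T 0 with hT | hT
  · simp [Icc_eq_empty_of_lt hT]
  have hcpt : IsCompact (Icc (-1) (T + 1)) := isCompact_Icc
  obtain ⟨M, hM⟩ := hcpt.exists_bound_of_continuousOn hp.continuousOn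
  have hM0 : 0 ≤ M := (norm_nonneg _).trans (hM 0 ⟨by norm_num, by linarith⟩)
  obtain ⟨δ, hδ, hunif⟩ := Metric.uniformContinuousOn_iff_le.1
    (hcpt.uniformContinuousOn_of_continuous hp.continuousOn) (ε / (T + 1)) (by positivity)
  let δ' := min (min δ 1) (ε / (2 * (M + 1)))
  have hδ' : 0 < δ' := lt_min (lt_min hδ one_pos) (by positivity)
  filter_upwards [eventually_ge_atTop (Real.pi / δ')] with ω hω t ht
  have hω0 : 0 < ω := (by positivity : 0 < Real.pi / δ').trans_le hω
  have hnω : (n : ℝ) * ω ≠ 0 := mul_ne_zero (by exact_mod_cast hn) hω0.ne'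
  let h : ℝ := Real.pi / (n * ω)
  have hhδ : |h| ≤ δ' := by
    have h1 : (1 : ℝ) ≤ |(n : ℝ)| := by exact_mod_cast Int.one_le_abs hn
    rw [abs_div, abs_mul, abs_of_pos Real.pi_pos, abs_of_pos hω0]
    rw [div_le_iff₀ hδ'] at hω
    rw [div_le_iff₀ (by positivity)]
    nlinarith [mul_pos hδ' hω0]
  have hh1 : |h| ≤ 1 := hhδ.trans ((min_le_left _ _).trans (min_le_right _ _))
  have hhδ1 : |h| ≤ δ := hhδ.trans ((min_le_left _ _).trans (min_le_left _ _))
  have hhM : M * |h| ≤ ε / 2 := by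
    have h1 : |h| ≤ ε / (2 * (M + 1)) := hhδ.trans (min_le_right _ _)
    rw [le_div_iff₀ (by positivity)] at h1
    nlinarith [abs_nonneg h]
  let e : ℝ → ℂ := fun τ => Complex.exp ((n * ω * τ : ℝ) * Complex.I)
  have he : Continuous e := by fun_prop
  have hen : ∀ τ, ‖e τ‖ = 1 := fun τ => Complex.norm_exp_ofReal_mul_I _
  have heh : ∀ τ, e (τ - h) = -e τ := fun τ => by
    have h1 : ((n * ω * (τ - h) : ℝ) : ℂ) * Complex.I =
        ((n * ω * τ : ℝ) : ℂ) * Complex.I - Real.pi * Complex.I := by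
      have h2 : n * ω * (τ - h) = n * ω * τ - Real.pi := by
        simp only [h]
        field_simp
      rw [h2]
      push_cast
      ring
    simp only [e]
    rw [h1, Complex.exp_sub, Complex.exp_pi_mul_I, div_neg, div_one]
  let q : ℝ → E := fun τ => e τ • p (τ - h)
  have hq : Continuous q := he.smul (hp.comp (continuous_id.sub continuous_const))
  have hii : ∀ a b, IntervalIntegrable q volume a b := fun a b => hq.intervalIntegrable a b
  have hep : Continuous fun τ => e τ • p τ := he.smul hp
  have hshift : ∫ τ in (0 : ℝ)..t, e τ • p τ = -∫ τ in h..(t + h), q τ := by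
    have h1 := intervalIntegral.integral_comp_sub_right (fun τ => e τ • p τ) h (a := h) (b := t + h)
    rw [sub_self, add_sub_cancel_right] at h1
    rw [← h1, ← intervalIntegral.integral_neg]
    refine intervalIntegral.integral_congr fun τ _ => ?_
    simp only [heh, q, neg_smul]
  have hsplit : ∫ τ in h..(t + h), q τ =
      (∫ τ in (0 : ℝ)..t, q τ) + (∫ τ in t..(t + h), q τ) - ∫ τ in (0 : ℝ)..h, q τ := by
    rw [intervalIntegral.integral_add_adjacent_intervals (hii _ _) (hii _ _), eq_sub_iff_add_eq',
      intervalIntegral.integral_add_adjacent_intervals (hii _ _) (hii _ _)]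
  have hend : ∀ a ∈ Icc 0 T, ‖∫ τ in a..(a + h), q τ‖ ≤ M * |h| := fun a ha => by
    have h1 := intervalIntegral.norm_integral_le_of_norm_le_const (f := q) (a := a) (b := a + h)
      (C := M) fun τ hτ => by
        rw [norm_smul, hen, one_mul]
        refine hM _ ?_
        have hτ' := uIoc_subset_uIcc hτ
        rw [mem_uIcc] at hτ'
        have := abs_le.1 hh1
        rcases hτ' with h | h <;> constructor <;> linarith [ha.1, ha.2, h.1, h.2]
    simpa using h1
  have hmid : ‖∫ τ in (0 : ℝ)..t, (e τ • p τ - q τ)‖ ≤ ε := by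
    have h1 := intervalIntegral.norm_integral_le_of_norm_le_const
      (f := fun τ => e τ • p τ - q τ) (a := 0) (b := t) (C := ε / (T + 1)) fun τ hτ => by
        rw [uIoc_of_le ht.1] at hτ
        have := abs_le.1 hh1
        rw [← smul_sub, norm_smul, hen, one_mul, ← dist_eq_norm]
        refine hunif _ ?_ _ ?_ ?_
        · constructor <;> linarith [hτ.1, hτ.2, ht.2]
        · constructor <;> linarith [hτ.1, hτ.2, ht.2]
        · rw [Real.dist_eq, sub_sub_cancel]
          exact hhδ1
    refine h1.trans ?_
    rw [sub_zero, abs_of_nonneg ht.1, div_mul_eq_mul_div, div_le_iff₀ (by positivity)]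
    nlinarith [ht.2]
  have h0 := hend 0 ⟨le_rfl, hT⟩
  rw [zero_add] at h0
  have htwo : (2 : ℝ) • ∫ τ in (0 : ℝ)..t, e τ • p τ =
      (∫ τ in (0 : ℝ)..t, (e τ • p τ - q τ)) - (∫ τ in t..(t + h), q τ) +
        ∫ τ in (0 : ℝ)..h, q τ := by
    rw [two_smul]
    nth_rewrite 2 [hshift]
    rw [hsplit, intervalIntegral.integral_sub (hep.intervalIntegrable _ _) (hii _ _)]
    abel
  have hfin : 2 * ‖∫ τ in (0 : ℝ)..t, e τ • p τ‖ ≤ 2 * ε := by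
    have h1 : ‖(2 : ℝ) • ∫ τ in (0 : ℝ)..t, e τ • p τ‖ = 2 * ‖∫ τ in (0 : ℝ)..t, e τ • p τ‖ := by
      rw [norm_smul]
      norm_num
    rw [← h1, htwo]
    have h2 := norm_add_le ((∫ τ in (0 : ℝ)..t, (e τ • p τ - q τ)) - ∫ τ in t..(t + h), q τ)
      (∫ τ in (0 : ℝ)..h, q τ)
    have h3 := norm_sub_le (∫ τ in (0 : ℝ)..t, (e τ • p τ - q τ)) (∫ τ in t..(t + h), q τ)
    linarith [hend t ht]
  linarith

section Averaging

variable {d : ℕ} {s : ℝ} [Fact ((d : ℝ) / 2 < s)]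

theorem cubic_sum_smul {ι : Type*} [Fintype ι] (a : ι → ℂ) (c : ι → SobolevSpace d s) :
    cubic (∑ l, a l • c l) = ∑ x : ι × ι × ι,
      (a x.1 * a x.2.1 * star (a x.2.2)) • trilin (c x.1) (c x.2.1) (c x.2.2) := by
  apply toCont_injective
  simp only [cubic, map_sum, map_smul, toCont_trilin, star_sum]
  ext y
  simp only [ContinuousMap.mul_apply, ContinuousMap.star_apply, ContinuousMap.sum_apply,
    ContinuousMap.smul_apply, smul_eq_mul, star_mul', Fintype.sum_prod_type]
  rw [Finset.sum_mul_sum, Finset.sum_mul]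
  refine Finset.sum_congr rfl fun i _ => ?_
  rw [Finset.sum_mul]
  refine Finset.sum_congr rfl fun j _ => ?_
  rw [Finset.mul_sum]
  refine Finset.sum_congr rfl fun k _ => ?_
  ring

/-- In the cubic nonlinearity of a superposition of oscillations `e^{i p_l ω τ} c_l(τ)` only the
resonant triples, those with `p_{l₁} + p_{l₂} = p_{l₃}`, survive as `ω → ∞`. -/
theorem eventually_norm_integral_cubic_sub_le {ι : Type*} [Fintype ι] (p : ι → ℤ)
    {c : ι → ℝ → SobolevSpace d s} (hc : ∀ l, Continuous (c l)) (T : ℝ) {ε : ℝ} (hε : 0 < ε) :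
    ∀ᶠ ω : ℝ in atTop, ∀ t ∈ Icc 0 T, ‖∫ τ in (0 : ℝ)..t, evol (-τ)
      (cubic (∑ l, Complex.exp ((p l * ω * τ : ℝ) * Complex.I) • c l τ) -
        ∑ x : ι × ι × ι, if p x.1 + p x.2.1 = p x.2.2 then
          trilin (c x.1 τ) (c x.2.1 τ) (c x.2.2 τ) else 0)‖ ≤ ε := by
  let n : ι × ι × ι → ℤ := fun x => p x.1 + p x.2.1 - p x.2.2
  let F : ι × ι × ι → ℝ → SobolevSpace d s := fun x τ =>
    evol (-τ) (trilin (c x.1 τ) (c x.2.1 τ) (c x.2.2 τ))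
  have hF : ∀ x, Continuous (F x) := fun x =>
    continuous_evol continuous_neg (continuous_trilin (hc _) (hc _) (hc _))
  let κ : ℝ := Fintype.card (ι × ι × ι) + 1
  have hκ : 0 < κ := by positivity
  have hall : ∀ᶠ ω : ℝ in atTop, ∀ x, n x ≠ 0 → ∀ t ∈ Icc 0 T,
      ‖∫ τ in (0 : ℝ)..t, Complex.exp ((n x * ω * τ : ℝ) * Complex.I) • F x τ‖ ≤ ε / κ := by
    refine eventually_all.2 fun x => ?_
    by_cases hx : n x = 0
    · simp [hx]
    · filter_upwards [eventually_norm_integral_exp_smul_le (hF x) T hx (div_pos hε hκ)] with ω h _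
      exact h
  filter_upwards [hall] with ω hω t ht
  have e1 : ∀ τ : ℝ, evol (-τ)
      (cubic (∑ l, Complex.exp ((p l * ω * τ : ℝ) * Complex.I) • c l τ) -
        ∑ x : ι × ι × ι, if p x.1 + p x.2.1 = p x.2.2 then
          trilin (c x.1 τ) (c x.2.1 τ) (c x.2.2 τ) else 0) =
      ∑ x, if n x = 0 then 0 else Complex.exp ((n x * ω * τ : ℝ) * Complex.I) • F x τ := by
    intro τ
    rw [cubic_sum_smul, ← Finset.sum_sub_distrib, map_sum]
    refine Finset.sum_congr rfl fun x _ => ?_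
    have h1 : Complex.exp ((p x.1 * ω * τ : ℝ) * Complex.I) *
        Complex.exp ((p x.2.1 * ω * τ : ℝ) * Complex.I) *
        star (Complex.exp ((p x.2.2 * ω * τ : ℝ) * Complex.I)) =
        Complex.exp ((n x * ω * τ : ℝ) * Complex.I) := by
      rw [Complex.star_def, ← Complex.exp_conj, ← Complex.exp_add, ← Complex.exp_add, map_mul,
        Complex.conj_I, Complex.conj_ofReal]
      congr 1
      simp only [n]
      push_cast
      ring
    rw [h1]
    have h2 : n x = 0 ↔ p x.1 + p x.2.1 = p x.2.2 := sub_eq_zero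
    by_cases hx : n x = 0
    · rw [if_pos hx, if_pos (h2.1 hx), hx]
      simp
    · rw [if_neg hx, if_neg (fun h => hx (h2.2 h)), sub_zero, map_smul]
  have hcont : ∀ x, Continuous fun τ : ℝ =>
      if n x = 0 then (0 : SobolevSpace d s) else
        Complex.exp ((n x * ω * τ : ℝ) * Complex.I) • F x τ := fun x => by
    split_ifs
    · exact continuous_const
    · exact (continuous_exp_ofReal_mul_I (n x * ω)).smul (hF x)
  simp only [e1]
  rw [intervalIntegral.integral_finsetSum fun x _ => (hcont x).intervalIntegrable _ _]
  calc _ ≤ ∑ _x : ι × ι × ι, ε / κ := by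
        refine norm_sum_le_of_le _ fun x _ => ?_
        by_cases hx : n x = 0
        · simp only [if_pos hx, intervalIntegral.integral_zero, norm_zero]
          positivity
        · simp only [if_neg hx]
          exact hω x hx t ht
    _ = ε * (Fintype.card (ι × ι × ι) / κ) := by
        rw [Finset.sum_const, nsmul_eq_mul, Finset.card_univ]
        ring
    _ ≤ ε := mul_le_of_le_one_right hε.le ((div_le_one hκ).2 (by simp [κ]))

theorem mode_mul_star (k : Fin d → ℤ) :
    (UnitAddTorus.mFourier k : C(Torus d, ℂ)) * star (UnitAddTorus.mFourier k) = 1 := by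
  ext x
  rw [ContinuousMap.mul_apply, ContinuousMap.star_apply, Complex.star_def,
    ← UnitAddTorus.mFourier_neg, ← UnitAddTorus.mFourier_add, add_neg_cancel,
    UnitAddTorus.mFourier_zero]

theorem trilin_mode_mode (y : SobolevSpace d s) (a : ℂ) (k : Fin d → ℤ) :
    trilin y (a • mode d s k) (a • mode d s k) = ((‖a‖ ^ 2 : ℝ) : ℂ) • y := by
  apply toCont_injective
  ext x
  have h := congrArg (fun f : C(Torus d, ℂ) => f x) (mode_mul_star k)
  simp only [ContinuousMap.mul_apply, ContinuousMap.star_apply, ContinuousMap.one_apply] at h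
  simp only [map_smul, toCont_trilin, toCont_mode, ContinuousMap.mul_apply,
    ContinuousMap.star_apply, ContinuousMap.smul_apply, smul_eq_mul, star_mul']
  have ha : a * star a = ((‖a‖ ^ 2 : ℝ) : ℂ) := by
    rw [Complex.star_def, Complex.mul_conj, Complex.normSq_eq_norm_sq]
  linear_combination (toCont y x * (a * star a)) * h + toCont y x * ha

theorem trilin_comm (u v w : SobolevSpace d s) : trilin u v w = trilin v u w := by
  apply toCont_injective
  rw [toCont_trilin, toCont_trilin, mul_comm (toCont u)]

theorem trilin_mode_resonant (a b : ℂ) (r m : Fin d → ℤ) :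
    trilin (a • mode d s r) (a • mode d s r) (b • mode d s m) =
      (a ^ 2 * star b) • mode d s (2 • r - m) := by
  apply toCont_injective
  ext x
  simp only [map_smul, toCont_trilin, toCont_mode, ContinuousMap.mul_apply,
    ContinuousMap.star_apply, ContinuousMap.smul_apply, smul_eq_mul, star_mul']
  rw [two_smul, sub_eq_add_neg, UnitAddTorus.mFourier_add, UnitAddTorus.mFourier_add,
    UnitAddTorus.mFourier_neg, Complex.star_def]
  ring

/-- The frequencies `0, 1, 2, 5` of the slow component and of the three oscillating components.
Besides the trivial identities `p + 0 = p`, the only relation `p + p' = p''` among them is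
`1 + 1 = 2`. -/
def freq : Fin 4 → ℤ := ![0, 1, 2, 5]

theorem sum_resonant (y : SobolevSpace d s) (a b c : ℂ) (r m : Fin d → ℤ) :
    (∑ x : Fin 4 × Fin 4 × Fin 4, if freq x.1 + freq x.2.1 = freq x.2.2 then
      trilin ((![y, a • mode d s r, b • mode d s m, c • mode d s r] : Fin 4 → _) x.1)
        ((![y, a • mode d s r, b • mode d s m, c • mode d s r] : Fin 4 → _) x.2.1)
        ((![y, a • mode d s r, b • mode d s m, c • mode d s r] : Fin 4 → _) x.2.2) else 0) =
      cubic y + ((2 * (‖a‖ ^ 2 + ‖b‖ ^ 2 + ‖c‖ ^ 2) : ℝ) : ℂ) • y +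
        (a ^ 2 * star b) • mode d s (2 • r - m) := by
  have h1 : ∀ (a : ℂ) (k : Fin d → ℤ), trilin (a • mode d s k) y (a • mode d s k) =
      ((‖a‖ ^ 2 : ℝ) : ℂ) • y := fun a k => by rw [trilin_comm, trilin_mode_mode]
  simp only [Fintype.sum_prod_type, Fin.sum_univ_four, freq]
  simp [-Complex.ofReal_pow, h1, trilin_mode_mode, trilin_mode_resonant, cubic]
  module

end Averaging

/-! ### Continuous controls -/

section Controls

/-- The control given by a continuous function. -/
def toControl (T : ℝ) (f : C(ℝ, ℂ)) : L1Control T :=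
  (memLp_one_iff_integrable.2 (f.continuous.integrableOn_Icc (a := 0) (b := T))).toLp f

theorem coeFn_toControl (T : ℝ) (f : C(ℝ, ℂ)) :
    (toControl T f : ℝ → ℂ) =ᵐ[volume.restrict (Icc 0 T)] f :=
  MemLp.coeFn_toLp _

theorem norm_toControl_sub (T : ℝ) (x : L1Control T) (g : C(ℝ, ℂ)) :
    ‖x - toControl T g‖ = ∫ t in Icc 0 T, ‖x t - g t‖ := by
  rw [L1.norm_eq_integral_norm]
  refine integral_congr_ae ?_
  filter_upwards [Lp.coeFn_sub x (toControl T g), coeFn_toControl T g] with t h1 h2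
  rw [h1, Pi.sub_apply, h2]

theorem norm_toControl_sub_toControl_le {T : ℝ} (hT : 0 ≤ T) {f g : C(ℝ, ℂ)} {ε : ℝ}
    (h : ∀ t ∈ Icc 0 T, ‖f t - g t‖ ≤ ε) : ‖toControl T f - toControl T g‖ ≤ T * ε := by
  rw [norm_toControl_sub]
  have e : ∫ t in Icc 0 T, ‖toControl T f t - g t‖ = ∫ t in Icc 0 T, ‖f t - g t‖ := by
    refine integral_congr_ae ?_
    filter_upwards [coeFn_toControl T f] with t ht
    rw [ht]
  rw [e]
  calc ∫ t in Icc 0 T, ‖f t - g t‖ ≤ ∫ _t in Icc 0 T, ε :=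
        setIntegral_mono_on (f.continuous.sub g.continuous).norm.integrableOn_Icc
          continuous_const.integrableOn_Icc measurableSet_Icc h
    _ = T * ε := by simp [hT]

theorem eventually_forall_norm_sub_lt {P : Type*} [TopologicalSpace P]
    {f : P → C(ℝ, ℂ)} (hf : Continuous f) (b₀ : P) (T : ℝ) {ε : ℝ} (hε : 0 < ε) :
    ∀ᶠ b in 𝓝 b₀, ∀ t ∈ Icc 0 T, ‖f b t - f b₀ t‖ < ε := by
  have h := ContinuousMap.tendsto_iff_forall_isCompact_tendstoUniformlyOn.1 (hf.tendsto b₀)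
    (Icc 0 T) isCompact_Icc
  filter_upwards [Metric.tendstoUniformlyOn_iff.1 h ε hε] with b hb t ht
  rw [← dist_eq_norm, dist_comm]
  exact hb t ht

theorem continuous_toControl {T : ℝ} (hT : 0 ≤ T) : Continuous (toControl T) := by
  rw [continuous_iff_continuousAt]
  intro f
  rw [ContinuousAt, Metric.tendsto_nhds]
  intro ε hε
  filter_upwards [eventually_forall_norm_sub_lt continuous_id f T
    (div_pos hε (by linarith : 0 < T + 1))] with g hg
  rw [dist_eq_norm]
  refine (norm_toControl_sub_toControl_le hT fun t ht => (hg t ht).le).trans_lt ?_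
  rw [mul_div_assoc', div_lt_iff₀ (by linarith)]
  nlinarith

end Controls

section Duhamel

variable {d : ℕ} {s : ℝ} {T : ℝ}

theorem duhamel_toControl (K : Finset (Fin d → ℤ)) (u₀ : SobolevSpace d s)
    (V : (Fin d → ℤ) → C(ℝ, ℂ)) {t : ℝ} (ht : t ∈ Icc 0 T) :
    duhamel u₀ (fun k : K => toControl T (V k)) t =
      u₀ + Complex.I • ∫ τ in (0 : ℝ)..t, ∑ k ∈ K, (V k τ * phase (-τ) k) • mode d s k := by
  rw [duhamel]
  congr 2
  rw [intervalIntegral.integral_of_le ht.1, intervalIntegral.integral_of_le ht.1]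
  have hae : ∀ᵐ τ ∂(volume.restrict (Ioc 0 t)), ∀ k : K, toControl T (V k) τ = V k τ := by
    refine ae_all_iff.2 fun k => ?_
    have hsub : Ioc 0 t ⊆ Icc 0 T := fun τ hτ => ⟨hτ.1.le, hτ.2.trans ht.2⟩
    exact ae_restrict_of_ae_restrict_of_subset hsub (coeFn_toControl T (V k))
  refine integral_congr_ae ?_
  filter_upwards [hae] with τ hτ
  rw [evol_sourceTerm, ← Finset.sum_coe_sort K]
  simp only [hτ]

theorem hasDerivAt_exp_ofReal_mul_I (c τ : ℝ) :
    HasDerivAt (fun τ : ℝ => Complex.exp ((c * τ : ℝ) * Complex.I))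
      (Complex.exp ((c * τ : ℝ) * Complex.I) * (c * Complex.I)) τ := by
  have h : HasDerivAt (fun τ : ℝ => ((c * τ : ℝ) : ℂ) * Complex.I) (c * Complex.I) τ := by
    have h1 := ((hasDerivAt_id τ).const_mul c).ofReal_comp.mul_const Complex.I
    simpa using h1
  exact h.cexp

theorem hasDerivAt_phase_neg (k : Fin d → ℤ) (τ : ℝ) :
    HasDerivAt (fun τ => phase (-τ) k) (phase (-τ) k * (-normSq k * Complex.I)) τ := by
  have h := hasDerivAt_exp_ofReal_mul_I (-normSq k) τ
  have e : ∀ τ : ℝ, phase (-τ) k = Complex.exp ((-normSq k * τ : ℝ) * Complex.I) := fun τ => by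
    rw [phase]
    congr 3
    ring
  simp only [e]
  simpa using h

/-- The function `τ ↦ e^{iντ}`. -/
def expMap (ν : ℝ) : C(ℝ, ℂ) :=
  ⟨fun τ => Complex.exp ((ν * τ : ℝ) * Complex.I), continuous_exp_ofReal_mul_I ν⟩

/-- The control in the mode `k` that produces the oscillation `e^{iνt} a(t) e^{ik·x}` in the linear
Schrödinger equation; `a'` is the derivative of `a`. -/
def oscControl (k : Fin d → ℤ) (ν : ℝ) (a a' : C(ℝ, ℂ)) : C(ℝ, ℂ) :=
  -Complex.I • (expMap ν * (a' + (Complex.I * (ν - normSq k)) • a))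

theorem integral_oscControl (k : Fin d → ℤ) (ν : ℝ) {a a' : C(ℝ, ℂ)}
    (ha : ∀ t, HasDerivAt a (a' t) t) (h0 : a 0 = 0) (t : ℝ) :
    Complex.I * ∫ τ in (0 : ℝ)..t, oscControl k ν a a' τ * phase (-τ) k =
      phase (-t) k * (expMap ν t * a t) := by
  have hder : ∀ τ : ℝ, HasDerivAt (fun τ => phase (-τ) k * (expMap ν τ * a τ))
      (Complex.I * (oscControl k ν a a' τ * phase (-τ) k)) τ := fun τ => by
    have h := (hasDerivAt_phase_neg k τ).mul ((hasDerivAt_exp_ofReal_mul_I ν τ).mul (ha τ))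
    refine h.congr_deriv ?_
    simp only [Pi.mul_apply, oscControl, expMap, ContinuousMap.smul_apply, ContinuousMap.mul_apply,
      ContinuousMap.add_apply, ContinuousMap.coe_mk, smul_eq_mul]
    linear_combination (phase (-τ) k * Complex.exp ((ν * τ : ℝ) * Complex.I) *
      (a' τ + Complex.I * (ν - normSq k) * a τ)) * Complex.I_mul_I
  have hc : Continuous fun τ => Complex.I * (oscControl k ν a a' τ * phase (-τ) k) :=
    continuous_const.mul ((oscControl k ν a a').continuous.mul
      ((continuous_phase k).comp continuous_neg))
  rw [← intervalIntegral.integral_const_mul,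
    intervalIntegral.integral_eq_sub_of_hasDerivAt (fun τ _ => hder τ) (hc.intervalIntegrable _ _)]
  simp [h0]

/-- The control in the mode `k` with slow part `V k` that produces, for each `l` with `κ_l = k`, an
oscillation `e^{iν_l t} a_l(t)` of this mode. -/
def fastControl {ι : Type*} [Fintype ι] (V : (Fin d → ℤ) → C(ℝ, ℂ)) (κ : ι → Fin d → ℤ) (ν : ι → ℝ)
    (a a' : ι → C(ℝ, ℂ)) (k : Fin d → ℤ) : C(ℝ, ℂ) :=
  V k + ∑ l, if k = κ l then oscControl (κ l) (ν l) (a l) (a' l) else 0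

theorem duhamel_fastControl [Fact ((d : ℝ) / 2 < s)] {ι : Type*} [Fintype ι]
    {K : Finset (Fin d → ℤ)} (u₀ : SobolevSpace d s) (V : (Fin d → ℤ) → C(ℝ, ℂ))
    {κ : ι → Fin d → ℤ} (hκ : ∀ l, κ l ∈ K)
    (ν : ι → ℝ) {a a' : ι → C(ℝ, ℂ)} (ha : ∀ l t, HasDerivAt (a l) (a' l t) t)
    (h0 : ∀ l, a l 0 = 0) {t : ℝ} (ht : t ∈ Icc 0 T) :
    duhamel u₀ (fun k : K => toControl T (fastControl V κ ν a a' k)) t =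
      u₀ + (Complex.I • ∫ τ in (0 : ℝ)..t, ∑ k ∈ K, (V k τ * phase (-τ) k) • mode d s k) +
        evol (-t) (∑ l, (expMap (ν l) t * a l t) • mode d s (κ l)) := by
  have hphase : ∀ k : Fin d → ℤ, Continuous fun τ : ℝ => phase (-τ) k := fun k =>
    (continuous_phase k).comp continuous_neg
  have e1 : ∀ τ, ∑ k ∈ K, (fastControl V κ ν a a' k τ * phase (-τ) k) • mode d s k =
      ∑ k ∈ K, (V k τ * phase (-τ) k) • mode d s k +
        ∑ l, (oscControl (κ l) (ν l) (a l) (a' l) τ * phase (-τ) (κ l)) • mode d s (κ l) := by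
    intro τ
    have h1 : ∀ k, (fastControl V κ ν a a' k τ * phase (-τ) k) • mode d s k =
        (V k τ * phase (-τ) k) • mode d s k + ∑ l, if k = κ l then
          (oscControl (κ l) (ν l) (a l) (a' l) τ * phase (-τ) k) • mode d s k else 0 := fun k => by
      rw [fastControl, ContinuousMap.add_apply, ContinuousMap.sum_apply, add_mul, add_smul,
        Finset.sum_mul, Finset.sum_smul]
      congr 1
      refine Finset.sum_congr rfl fun l _ => ?_
      split_ifs <;> simp
    simp only [h1, Finset.sum_add_distrib]
    congr 1
    rw [Finset.sum_comm]
    refine Finset.sum_congr rfl fun l _ => ?_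
    rw [Finset.sum_ite_eq' K (κ l), if_pos (hκ l)]
  have hosc : ∀ l, Continuous fun τ : ℝ =>
      (oscControl (κ l) (ν l) (a l) (a' l) τ * phase (-τ) (κ l)) • mode d s (κ l) := fun l =>
    ((oscControl _ _ _ _).continuous.mul (hphase _)).smul continuous_const
  have hV : Continuous fun τ : ℝ => ∑ k ∈ K, (V k τ * phase (-τ) k) • mode d s k :=
    continuous_finsetSum _ fun k _ => ((V k).continuous.mul (hphase k)).smul continuous_const
  rw [duhamel_toControl K u₀ _ ht]
  simp only [e1]
  rw [intervalIntegral.integral_add (hV.intervalIntegrable _ _)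
    ((continuous_finsetSum _ fun l _ => hosc l).intervalIntegrable _ _),
    intervalIntegral.integral_finsetSum fun l _ => (hosc l).intervalIntegrable _ _, smul_add,
    ← add_assoc, map_sum, Finset.smul_sum]
  congr 1
  refine Finset.sum_congr rfl fun l _ => ?_
  rw [intervalIntegral.integral_smul_const, smul_smul, integral_oscControl _ _ (ha l) (h0 l),
    map_smul, evol_mode, smul_smul, mul_comm (phase _ _)]

end Duhamel

/-! ### Fast oscillations generate the resonant mode -/

section FastOscillation

variable {d : ℕ} {s : ℝ} {T : ℝ}

/-- The function `t ↦ e^{iθ(t)}`. -/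
def gaugeMap (θ : C(ℝ, ℝ)) : C(ℝ, ℂ) :=
  ⟨fun t => Complex.exp ((θ t : ℝ) * Complex.I), by fun_prop⟩

theorem norm_gaugeMap (θ : C(ℝ, ℝ)) (t : ℝ) : ‖gaugeMap θ t‖ = 1 :=
  Complex.norm_exp_ofReal_mul_I _

theorem hasDerivAt_gaugeMap {θ θ' : C(ℝ, ℝ)} (hθ : ∀ t, HasDerivAt θ (θ' t) t) (t : ℝ) :
    HasDerivAt (gaugeMap θ) (gaugeMap θ t * ((θ' t : ℝ) * Complex.I)) t :=
  ((hθ t).ofReal_comp.mul_const Complex.I).cexp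

/-- The oscillating field `∑_l e^{i p_l ω t} a_l(t) e^{iκ_l·x}` with `p = (1, 2, 5)` and
`κ = (r, m, r)`. -/
def fastField (s : ℝ) (r m : Fin d → ℤ) (a : Fin 3 → C(ℝ, ℂ)) (ω t : ℝ) : SobolevSpace d s :=
  ∑ l : Fin 3, (expMap (freq l.succ * ω) t * a l t) • mode d s ((![r, m, r] : Fin 3 → _) l)

/-- The gauge-transformed curve `e^{iθ} α` superposed with the oscillating field, in the interaction
picture. -/
def fastCurve (r m : Fin d → ℤ) (α : ℝ → SobolevSpace d s) (θ : C(ℝ, ℝ)) (a : Fin 3 → C(ℝ, ℂ))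
    (ω t : ℝ) : SobolevSpace d s :=
  gaugeMap θ t • α t + evol (-t) (fastField s r m a ω t)

theorem continuous_fastField (r m : Fin d → ℤ) (a : Fin 3 → C(ℝ, ℂ)) (ω : ℝ) :
    Continuous (fastField s r m a ω) :=
  continuous_finsetSum _ fun l _ =>
    ((expMap _).continuous.mul (a l).continuous).smul continuous_const

theorem continuous_fastCurve (r m : Fin d → ℤ) {α : ℝ → SobolevSpace d s} (hα : Continuous α)
    (θ : C(ℝ, ℝ)) (a : Fin 3 → C(ℝ, ℂ)) (ω : ℝ) : Continuous (fastCurve r m α θ a ω) :=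
  ((gaugeMap θ).continuous.smul hα).add
    (continuous_evol continuous_neg (continuous_fastField r m a ω))

/-- The controls in the modes of `K` that excite the oscillating field on top of the
gauge-transformed controls `e^{iθ} W`. -/
def resonantControl (T : ℝ) (K : Finset (Fin d → ℤ)) (W : (Fin d → ℤ) → C(ℝ, ℂ)) (r m : Fin d → ℤ)
    (θ : C(ℝ, ℝ)) (a a' : Fin 3 → C(ℝ, ℂ)) (ω : ℝ) (k : K) : L1Control T :=
  toControl T (fastControl (fun k => gaugeMap θ * W k) ![r, m, r] (fun l => freq l.succ * ω) a a' k)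

variable [Fact ((d : ℝ) / 2 < s)]

theorem cubic_smul_of_norm_eq_one {c : ℂ} (hc : ‖c‖ = 1) (u : SobolevSpace d s) :
    cubic (c • u) = c • cubic u := by
  apply toCont_injective
  ext x
  simp only [cubic, map_smul, toCont_trilin, ContinuousMap.mul_apply, ContinuousMap.star_apply,
    ContinuousMap.smul_apply, smul_eq_mul, star_mul']
  have h : c * star c = 1 := by
    rw [Complex.star_def, Complex.mul_conj, Complex.normSq_eq_norm_sq, hc]
    norm_num
  linear_combination (c * toCont u x * toCont u x * star (toCont u x)) * h

/-- The product rule for `e^{iθ} α`, in integrated form. -/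
theorem gaugeMap_smul_eq {u₀ : SobolevSpace d s} {α G : ℝ → SobolevSpace d s} (hG : Continuous G)
    (hα : ∀ t ∈ Icc 0 T, α t = u₀ + ∫ τ in (0 : ℝ)..t, G τ) {θ θ' : C(ℝ, ℝ)}
    (hθ : ∀ t, HasDerivAt θ (θ' t) t) (hθ0 : θ 0 = 0) {t : ℝ} (ht : t ∈ Icc 0 T) :
    gaugeMap θ t • α t = u₀ + ∫ τ in (0 : ℝ)..t,
      (gaugeMap θ τ • G τ + (gaugeMap θ τ * ((θ' τ : ℝ) * Complex.I)) • α τ) := by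
  let β : ℝ → SobolevSpace d s := fun t => u₀ + ∫ τ in (0 : ℝ)..t, G τ
  have hβ : ∀ t, HasDerivAt β (G t) t := fun t =>
    (hG.integral_hasStrictDerivAt 0 t).hasDerivAt.const_add u₀
  have hβc : Continuous β := continuous_iff_continuousAt.2 fun t => (hβ t).continuousAt
  have hder : ∀ τ, HasDerivAt (fun τ => gaugeMap θ τ • β τ)
      (gaugeMap θ τ • G τ + (gaugeMap θ τ * ((θ' τ : ℝ) * Complex.I)) • β τ) τ := fun τ =>
    (hasDerivAt_gaugeMap hθ τ).smul (hβ τ)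
  have hc : Continuous fun τ =>
      gaugeMap θ τ • G τ + (gaugeMap θ τ * ((θ' τ : ℝ) * Complex.I)) • β τ :=
    ((gaugeMap θ).continuous.smul hG).add (((gaugeMap θ).continuous.mul
      ((Complex.continuous_ofReal.comp θ'.continuous).mul continuous_const)).smul hβc)
  have hint := intervalIntegral.integral_eq_sub_of_hasDerivAt (fun τ _ => hder τ)
    (hc.intervalIntegrable 0 t)
  have h0 : gaugeMap θ 0 • β 0 = u₀ := by
    simp [β, gaugeMap, hθ0]
  have hβα : β t = α t := (hα t ht).symm
  rw [h0, hβα] at hint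
  rw [← sub_eq_iff_eq_add', ← hint]
  refine intervalIntegral.integral_congr fun τ hτ => ?_
  rw [uIcc_of_le ht.1] at hτ
  simp only [hα τ ⟨hτ.1, hτ.2.trans ht.2⟩, β]

/-- Let `α` be the trajectory, in the interaction picture, of the controls `W` in the modes of
`K ∪ {2r - m}`. If the amplitudes satisfy `a₀² ā₁ = e^{iθ} W_{2r-m}` and
`θ' = 2 (|a₀|² + |a₁|² + |a₂|²)`, then the control of the mode `2r - m` is the average of the
resonant part of the cubic term, the phase `θ` absorbs the averages of the remaining terms, and
`fastCurve` solves the equation with the controls `resonantControl` in the modes of `K` up to an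
error that vanishes as `ω → ∞`. -/
theorem eventually_norm_duhamel_resonantControl_sub_le {K : Finset (Fin d → ℤ)}
    {u₀ : SobolevSpace d s} {W : (Fin d → ℤ) → C(ℝ, ℂ)} {r m : Fin d → ℤ} (hr : r ∈ K) (hm : m ∈ K)
    (hrm : 2 • r - m ∉ K) {α : ℝ → SobolevSpace d s} (hα : Continuous α)
    (hαe : ∀ t ∈ Icc 0 T, α t = u₀ + (Complex.I • ∫ τ in (0 : ℝ)..t,
      ∑ k ∈ K ∪ {2 • r - m}, (W k τ * phase (-τ) k) • mode d s k) +
        ∫ τ in (0 : ℝ)..t, drift τ (α τ))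
    {θ θ' : C(ℝ, ℝ)} (hθ : ∀ t, HasDerivAt θ (θ' t) t) (hθ0 : θ 0 = 0)
    {a a' : Fin 3 → C(ℝ, ℂ)} (ha : ∀ l t, HasDerivAt (a l) (a' l t) t) (ha0 : ∀ l, a l 0 = 0)
    (hθ' : ∀ t, θ' t = 2 * (‖a 0 t‖ ^ 2 + ‖a 1 t‖ ^ 2 + ‖a 2 t‖ ^ 2))
    (hres : ∀ t, a 0 t ^ 2 * star (a 1 t) = gaugeMap θ t * W (2 • r - m) t)
    {η : ℝ} (hη : 0 < η) :
    ∀ᶠ ω : ℝ in atTop, ∀ t ∈ Icc 0 T,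
      ‖duhamel u₀ (resonantControl T K W r m θ a a' ω) t - (fastCurve r m α θ a ω t -
        ∫ τ in (0 : ℝ)..t, drift τ (fastCurve r m α θ a ω τ))‖ ≤ η := by
  have hphase : ∀ k : Fin d → ℤ, Continuous fun τ : ℝ => phase (-τ) k := fun k =>
    (continuous_phase k).comp continuous_neg
  let y : ℝ → SobolevSpace d s := fun τ => evol τ (gaugeMap θ τ • α τ)
  have hy : Continuous y := continuous_evol continuous_id ((gaugeMap θ).continuous.smul hα)
  -- The component of the superposition that carries the frequency `freq l`.
  let c : Fin 4 → ℝ → SobolevSpace d s := fun l τ =>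
    (![y τ, a 0 τ • mode d s r, a 1 τ • mode d s m, a 2 τ • mode d s r] : Fin 4 → _) l
  have hc : ∀ l, Continuous (c l) := by
    have h1 : ∀ l k, Continuous fun τ => a l τ • mode d s k := fun l k =>
      (a l).continuous.smul continuous_const
    intro l
    fin_cases l
    · exact hy
    · exact h1 0 r
    · exact h1 1 m
    · exact h1 2 r
  have hsum : ∀ ω τ : ℝ, ∑ l, Complex.exp ((freq l * ω * τ : ℝ) * Complex.I) • c l τ =
      y τ + fastField s r m a ω τ := by
    intro ω τ
    rw [Fin.sum_univ_succ, fastField]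
    congr 1
    · simp [freq, c]
    · refine Finset.sum_congr rfl fun l _ => ?_
      rw [mul_smul]
      fin_cases l <;> rfl
  have hKc : ∀ (S : Finset (Fin d → ℤ)) (V : (Fin d → ℤ) → C(ℝ, ℂ)), Continuous fun τ : ℝ =>
      ∑ k ∈ S, (V k τ * phase (-τ) k) • mode d s k := fun S V =>
    continuous_finsetSum _ fun k _ => ((V k).continuous.mul (hphase k)).smul continuous_const
  have hdα : Continuous fun τ => drift τ (α τ) := continuous_drift.comp (continuous_id.prodMk hα)
  let G : ℝ → SobolevSpace d s := fun τ => Complex.I • (∑ k ∈ K ∪ {2 • r - m},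
    (W k τ * phase (-τ) k) • mode d s k) + drift τ (α τ)
  have hWc : Continuous fun τ : ℝ => Complex.I • ∑ k ∈ K ∪ {2 • r - m},
      (W k τ * phase (-τ) k) • mode d s k := (hKc _ W).const_smul Complex.I
  have hG : Continuous G := hWc.add hdα
  have hαG : ∀ t ∈ Icc 0 T, α t = u₀ + ∫ τ in (0 : ℝ)..t, G τ := fun t ht => by
    simp only [G]
    rw [hαe t ht, intervalIntegral.integral_add (hWc.intervalIntegrable _ _)
      (hdα.intervalIntegrable _ _), intervalIntegral.integral_smul, add_assoc]
  filter_upwards [eventually_norm_integral_cubic_sub_le freq hc T hη] with ω hω t ht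
  have hav := hω t ht
  have hfc : Continuous (fastCurve r m α θ a ω) := continuous_fastCurve r m hα θ a ω
  have hdf : Continuous fun τ => drift τ (fastCurve r m α θ a ω τ) :=
    continuous_drift.comp (continuous_id.prodMk hfc)
  have hGc : Continuous fun τ =>
      gaugeMap θ τ • G τ + (gaugeMap θ τ * ((θ' τ : ℝ) * Complex.I)) • α τ :=
    ((gaugeMap θ).continuous.smul hG).add (((gaugeMap θ).continuous.mul
      ((Complex.continuous_ofReal.comp θ'.continuous).mul continuous_const)).smul hα)
  have hκ : ∀ l, (![r, m, r] : Fin 3 → _) l ∈ K := by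
    intro l
    fin_cases l
    · exact hr
    · exact hm
    · exact hr
  have hVc : Continuous fun τ : ℝ => Complex.I • ∑ k ∈ K,
      ((gaugeMap θ * W k) τ * phase (-τ) k) • mode d s k :=
    (hKc K fun k => gaugeMap θ * W k).const_smul Complex.I
  have hVGc : Continuous fun τ : ℝ => (Complex.I • ∑ k ∈ K,
      ((gaugeMap θ * W k) τ * phase (-τ) k) • mode d s k) -
      (gaugeMap θ τ • G τ + (gaugeMap θ τ * ((θ' τ : ℝ) * Complex.I)) • α τ) := hVc.sub hGc
  -- The error is exactly the non-resonant part of the cubic term.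
  have hkey : duhamel u₀ (resonantControl T K W r m θ a a' ω) t - (fastCurve r m α θ a ω t -
        ∫ τ in (0 : ℝ)..t, drift τ (fastCurve r m α θ a ω τ)) =
      Complex.I • ∫ τ in (0 : ℝ)..t, evol (-τ)
        (cubic (∑ l, Complex.exp ((freq l * ω * τ : ℝ) * Complex.I) • c l τ) -
        ∑ x : Fin 4 × Fin 4 × Fin 4, if freq x.1 + freq x.2.1 = freq x.2.2 then
          trilin (c x.1 τ) (c x.2.1 τ) (c x.2.2 τ) else 0) := by
    have e0 : duhamel u₀ (resonantControl T K W r m θ a a' ω) t = _ :=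
      duhamel_fastControl u₀ (fun k => gaugeMap θ * W k) hκ (fun l => freq l.succ * ω) ha ha0 ht
    rw [e0, fastCurve, gaugeMap_smul_eq hG hαG hθ hθ0 ht]
    have e1 : ∀ U z A B : SobolevSpace d s, ∀ V, U + V + z - (U + A + z - B) = V - A + B := by
      intros
      abel
    rw [fastField, e1, ← intervalIntegral.integral_smul, ← intervalIntegral.integral_smul,
      ← intervalIntegral.integral_sub (hVc.intervalIntegrable _ _) (hGc.intervalIntegrable _ _),
      ← intervalIntegral.integral_add (hVGc.intervalIntegrable _ _)
        (hdf.intervalIntegrable _ _)]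
    refine intervalIntegral.integral_congr fun τ _ => ?_
    have hdrift : drift τ (fastCurve r m α θ a ω τ) =
        Complex.I • evol (-τ) (cubic (y τ + fastField s r m a ω τ)) := by
      rw [drift, fastCurve, map_add, evol_evol_neg]
    have hcub : gaugeMap θ τ • drift τ (α τ) = Complex.I • evol (-τ) (cubic (y τ)) := by
      simp only [y]
      rw [map_smul, cubic_smul_of_norm_eq_one (norm_gaugeMap θ τ), map_smul, smul_comm, drift]
    have hyτ : evol (-τ) (y τ) = gaugeMap θ τ • α τ := evol_neg_evol τ _
    have hdisj : Disjoint K {2 • r - m} := by simpa using hrm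
    have hWs : gaugeMap θ τ • (Complex.I • ∑ k ∈ K ∪ {2 • r - m},
        (W k τ * phase (-τ) k) • mode d s k) =
        Complex.I • (∑ k ∈ K, ((gaugeMap θ * W k) τ * phase (-τ) k) • mode d s k) +
        Complex.I • evol (-τ) ((a 0 τ ^ 2 * star (a 1 τ)) • mode d s (2 • r - m)) := by
      rw [hres, Finset.sum_union hdisj, Finset.sum_singleton, map_smul, evol_mode]
      simp only [ContinuousMap.mul_apply, smul_add, Finset.smul_sum, smul_smul]
      congr 1
      · refine Finset.sum_congr rfl fun k _ => ?_
        congr 1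
        ring
      · congr 1
        ring
    rw [hsum]
    simp only [c]
    rw [sum_resonant, ← hθ', hdrift]
    simp only [G, smul_add]
    rw [hcub, hWs, map_sub, map_add, map_add, map_smul (evol (-τ)) _ (y τ), hyτ]
    module
  rw [hkey, norm_smul, Complex.norm_I, one_mul]
  exact hav

end FastOscillation

/-! ### Choice of the amplitudes and of the phase -/

section Amplitudes

/-- The bump `t ↦ (t (T - t))²`, which vanishes at the ends of `[0, T]`. The square makes it
nonnegative on the whole line. -/
def bump (T : ℝ) : C(ℝ, ℂ) := ⟨fun t => (((t * (T - t)) ^ 2 : ℝ) : ℂ), by fun_prop⟩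

theorem continuous_gaugeMap : Continuous gaugeMap :=
  ContinuousMap.continuous_postcomp
    (⟨fun x : ℝ => Complex.exp (x * Complex.I), by fun_prop⟩ : C(ℝ, ℂ))

/-- Amplitudes and a phase as required by `eventually_norm_duhamel_resonantControl_sub_le`, for a
control `(bump T)³ q` of the mode `2r - m`. The amplitudes vanish at time `T` and the phase is then
a multiple of `2π`, so that the end-point is not affected. -/
theorem exists_amplitudes {P : Type*} [TopologicalSpace P] [CompactSpace P]
    [FirstCountableTopology P] {T : ℝ} (hT : 0 < T) {q q' : P → C(ℝ, ℂ)} (hq : Continuous q)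
    (hq' : Continuous q') (hqd : ∀ b t, HasDerivAt (q b) (q' b t) t) :
    ∃ (θ θ' : P → C(ℝ, ℝ)) (a a' : P → Fin 3 → C(ℝ, ℂ)), Continuous θ ∧
      (∀ l, Continuous fun b => a b l) ∧ (∀ l, Continuous fun b => a' b l) ∧
      ∀ b, (∀ t, HasDerivAt (θ b) (θ' b t) t) ∧ θ b 0 = 0 ∧ gaugeMap (θ b) T = 1 ∧
        (∀ l t, HasDerivAt (a b l) (a' b l t) t) ∧ (∀ l, a b l 0 = 0) ∧ (∀ l, a b l T = 0) ∧
        (∀ t, θ' b t = 2 * (‖a b 0 t‖ ^ 2 + ‖a b 1 t‖ ^ 2 + ‖a b 2 t‖ ^ 2)) ∧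
        ∀ t, a b 0 t ^ 2 * star (a b 1 t) = gaugeMap (θ b) t * (bump T ^ 3 * q b) t := by
  let h : ℝ → ℝ := fun t => (t * (T - t)) ^ 2
  have hh : Continuous h := by fun_prop
  have hqu : Continuous fun p : P × ℝ => q p.1 p.2 := (hq.comp continuous_fst).eval continuous_snd
  let I : P → ℝ := fun b => ∫ t in (0 : ℝ)..T, h t ^ 2 * (1 + ‖q b t‖ ^ 2)
  let J : ℝ := ∫ t in (0 : ℝ)..T, h t ^ 2
  have hI : Continuous I := by
    refine intervalIntegral.continuous_parametric_intervalIntegral_of_continuous' ?_ 0 T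
    exact ((hh.comp continuous_snd).pow 2).mul (continuous_const.add (hqu.norm.pow 2))
  have hJ : 0 < J := by
    refine intervalIntegral.intervalIntegral_pos_of_pos_on ((hh.pow 2).intervalIntegrable _ _)
      (fun t ht => ?_) hT
    have : 0 < t * (T - t) := mul_pos ht.1 (sub_pos.2 ht.2)
    positivity
  obtain ⟨n, hn⟩ : ∃ n : ℕ, ∀ b, I b ≤ Real.pi * n := by
    obtain ⟨C, hC⟩ := isCompact_univ.exists_bound_of_continuousOn hI.continuousOn
    obtain ⟨n, hn⟩ := exists_nat_ge (C / Real.pi)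
    refine ⟨n, fun b => ((le_abs_self _).trans (hC b (mem_univ b))).trans ?_⟩
    rw [div_le_iff₀ Real.pi_pos] at hn
    linarith
  -- `c` makes the total phase increment equal to `2πn` for every parameter.
  let c : P → ℝ := fun b => √((Real.pi * n - I b) / J)
  have hc : Continuous c := ((continuous_const.sub hI).div_const J).sqrt
  have hc2 : ∀ b, c b ^ 2 * J = Real.pi * n - I b := fun b => by
    rw [Real.sq_sqrt (div_nonneg (sub_nonneg.2 (hn b)) hJ.le), div_mul_cancel₀ _ hJ.ne']
  let θ'f : P → ℝ → ℝ := fun b t => 2 * (h t ^ 2 * (1 + ‖q b t‖ ^ 2) + c b ^ 2 * h t ^ 2)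
  have hθ'f : Continuous θ'f.uncurry := by
    refine continuous_const.mul (Continuous.add ?_ ?_)
    · exact ((hh.comp continuous_snd).pow 2).mul (continuous_const.add (hqu.norm.pow 2))
    · exact ((hc.comp continuous_fst).pow 2).mul ((hh.comp continuous_snd).pow 2)
  have hθ'fb : ∀ b, Continuous (θ'f b) := fun b => hθ'f.comp (Continuous.prodMk_right b)
  have hθf : Continuous fun p : P × ℝ => ∫ t in (0 : ℝ)..p.2, θ'f p.1 t :=
    intervalIntegral.continuous_parametric_primitive_of_continuous hθ'f
  let θ' : C(P, C(ℝ, ℝ)) := ContinuousMap.curry ⟨_, hθ'f⟩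
  let θ : C(P, C(ℝ, ℝ)) := ContinuousMap.curry ⟨_, hθf⟩
  have hθd : ∀ b t, HasDerivAt (θ b) (θ' b t) t := fun b t =>
    ((hθ'fb b).integral_hasStrictDerivAt 0 t).hasDerivAt
  have hθT : ∀ b, θ b T = n * (2 * Real.pi) := fun b => by
    have e : θ b T = 2 * (I b + c b ^ 2 * J) := by
      change ∫ t in (0 : ℝ)..T, θ'f b t = _
      rw [intervalIntegral.integral_const_mul, intervalIntegral.integral_add,
        intervalIntegral.integral_const_mul]
      · exact (((hh.pow 2).mul (continuous_const.add
          ((q b).continuous.norm.pow 2)))).intervalIntegrable _ _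
      · exact (continuous_const.mul (hh.pow 2)).intervalIntegrable _ _
    rw [e, hc2]
    ring
  let B' : C(ℝ, ℂ) := ⟨fun t => ((2 * (t * (T - t)) * (T - 2 * t) : ℝ) : ℂ), by fun_prop⟩
  have hB : ∀ t, HasDerivAt (bump T) (B' t) t := fun t => by
    have h1 : HasDerivAt (fun t : ℝ => (t * (T - t)) ^ 2) (2 * (t * (T - t)) * (T - 2 * t)) t := by
      refine (((hasDerivAt_id t).mul ((hasDerivAt_id t).const_sub T)).pow 2).congr_deriv ?_
      simp only [Pi.mul_apply, id, Nat.cast_ofNat, Nat.add_one_sub_one, pow_one]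
      ring
    exact h1.ofReal_comp
  have hBn : ∀ t, ‖bump T t‖ = h t := fun t => by
    change ‖((h t : ℝ) : ℂ)‖ = _
    rw [Complex.norm_real, Real.norm_of_nonneg (sq_nonneg _)]
  have hB0 : bump T 0 = 0 := by simp [bump]
  have hBT : bump T T = 0 := by simp [bump]
  let p : P → C(ℝ, ℂ) := fun b => bump T * (q b * gaugeMap (θ b))
  let ρ : C(ℝ, ℂ) := ⟨Complex.ofReal, Complex.continuous_ofReal⟩
  let g' : P → C(ℝ, ℂ) := fun b => gaugeMap (θ b) * (Complex.I • ρ.comp (θ' b))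
  let p' : P → C(ℝ, ℂ) := fun b => B' * (q b * gaugeMap (θ b)) +
    bump T * (q' b * gaugeMap (θ b) + q b * g' b)
  have hg : Continuous fun b => gaugeMap (θ b) := continuous_gaugeMap.comp θ.continuous
  have hρ : Continuous fun b => ρ.comp (θ' b) :=
    (ContinuousMap.continuous_postcomp ρ).comp θ'.continuous
  have hg' : Continuous g' := hg.mul (hρ.const_smul Complex.I)
  have hp : Continuous p := continuous_const.mul (hq.mul hg)
  have hp' : Continuous p' := (continuous_const.mul (hq.mul hg)).add
    (continuous_const.mul ((hq'.mul hg).add (hq.mul hg')))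
  have hpd : ∀ b t, HasDerivAt (p b) (p' b t) t := fun b t => by
    have h1 := (hB t).mul ((hqd b t).mul (hasDerivAt_gaugeMap (hθd b) t))
    refine h1.congr_deriv ?_
    simp only [p', g', ρ, ContinuousMap.add_apply, ContinuousMap.mul_apply,
      ContinuousMap.smul_apply, ContinuousMap.comp_apply, ContinuousMap.coe_mk, smul_eq_mul,
      Pi.mul_apply]
    ring
  have hstar : Continuous (star : C(ℝ, ℂ) → C(ℝ, ℂ)) :=
    ContinuousMap.continuous_postcomp (⟨star, continuous_star⟩ : C(ℂ, ℂ))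
  refine ⟨θ, θ', fun b => ![bump T, star (p b), (c b : ℂ) • bump T],
    fun b => ![B', star (p' b), (c b : ℂ) • B'], θ.continuous, fun l => ?_, fun l => ?_,
    fun b => ⟨hθd b, ?_, ?_, fun l t => ?_, fun l => ?_, fun l => ?_, fun t => ?_, fun t => ?_⟩⟩
  · fin_cases l
    · exact continuous_const
    · exact hstar.comp hp
    · exact (Complex.continuous_ofReal.comp hc).smul continuous_const
  · fin_cases l
    · exact continuous_const
    · exact hstar.comp hp'
    · exact (Complex.continuous_ofReal.comp hc).smul continuous_const
  · exact intervalIntegral.integral_same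
  · change Complex.exp ((θ b T : ℝ) * Complex.I) = 1
    rw [hθT, Complex.exp_eq_one_iff]
    exact ⟨n, by push_cast; ring⟩
  · fin_cases l
    · exact hB t
    · exact (hpd b t).star
    · exact (hB t).const_mul (c b : ℂ)
  · fin_cases l <;> simp [p, hB0]
  · fin_cases l <;> simp [p, hBT]
  · change θ'f b t = 2 * (‖bump T t‖ ^ 2 + ‖star (bump T t * (q b t * gaugeMap (θ b) t))‖ ^ 2 +
      ‖(c b : ℂ) * bump T t‖ ^ 2)
    rw [norm_star, norm_mul, norm_mul, norm_mul, norm_gaugeMap, hBn, Complex.norm_real,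
      Real.norm_eq_abs, mul_pow |c b|, sq_abs]
    simp only [θ'f]
    ring
  · change bump T t ^ 2 * star (star (bump T t * (q b t * gaugeMap (θ b) t))) =
      gaugeMap (θ b) t * (bump T t ^ 3 * q b t)
    rw [star_star]
    ring

end Amplitudes

/-! ### Removing one mode from a family of smooth controls -/

section RemoveMode

variable {d : ℕ} {s : ℝ} {T : ℝ}

theorem norm_fastCurve_le (r m : Fin d → ℤ) (α : ℝ → SobolevSpace d s) (θ : C(ℝ, ℝ))
    (a : Fin 3 → C(ℝ, ℂ)) (ω t : ℝ) :
    ‖fastCurve r m α θ a ω t‖ ≤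
      ‖α t‖ + ∑ l : Fin 3, ‖a l t‖ * ‖mode d s ((![r, m, r] : Fin 3 → _) l)‖ := by
  refine (norm_add_le _ _).trans (add_le_add ?_ ?_)
  · rw [norm_smul, norm_gaugeMap, one_mul]
  · rw [(evol (-t)).norm_map, fastField]
    refine norm_sum_le_of_le _ fun l _ => ?_
    have h1 : ‖expMap (freq l.succ * ω) t‖ = 1 := Complex.norm_exp_ofReal_mul_I _
    rw [norm_smul, norm_mul, h1, one_mul]

variable [Fact ((d : ℝ) / 2 < s)]

/-- The Duhamel terms of two oscillating controls are as close as their slow parts and amplitudes,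
whatever the frequencies. -/
theorem norm_duhamel_fastControl_sub_le (hT : 0 ≤ T) {ι : Type*} [Fintype ι]
    {K : Finset (Fin d → ℤ)} (u₀ : SobolevSpace d s) {V V₁ : (Fin d → ℤ) → C(ℝ, ℂ)}
    {κ : ι → Fin d → ℤ} (hκ : ∀ l, κ l ∈ K) (ν : ι → ℝ) {a a' a₁ a₁' : ι → C(ℝ, ℂ)}
    (ha : ∀ l t, HasDerivAt (a l) (a' l t) t) (h0 : ∀ l, a l 0 = 0)
    (ha₁ : ∀ l t, HasDerivAt (a₁ l) (a₁' l t) t) (h0₁ : ∀ l, a₁ l 0 = 0) {δ : ℝ}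
    (hV : ∀ k ∈ K, ∀ t ∈ Icc 0 T, ‖V k t - V₁ k t‖ ≤ δ)
    (hδ : ∀ l, ∀ t ∈ Icc 0 T, ‖a l t - a₁ l t‖ ≤ δ) {t : ℝ} (ht : t ∈ Icc 0 T) :
    ‖duhamel u₀ (fun k : K => toControl T (fastControl V κ ν a a' k)) t -
        duhamel u₀ (fun k : K => toControl T (fastControl V₁ κ ν a₁ a₁' k)) t‖ ≤
      δ * (∑ k : K, T * ‖mode d s (k : Fin d → ℤ)‖ + ∑ l, ‖mode d s (κ l)‖) := by
  rw [duhamel_fastControl u₀ V hκ ν ha h0 ht, duhamel_fastControl u₀ V₁ hκ ν ha₁ h0₁ ht,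
    ← duhamel_toControl K u₀ V ht, ← duhamel_toControl K u₀ V₁ ht, add_sub_add_comm, mul_add]
  refine (norm_add_le _ _).trans (add_le_add ?_ ?_)
  · refine (norm_duhamel_sub_le u₀ _ _ ht).trans ?_
    rw [Finset.mul_sum]
    refine Finset.sum_le_sum fun k _ => ?_
    have h := norm_toControl_sub_toControl_le hT (hV k k.2)
    calc _ ≤ T * δ * ‖mode d s (k : Fin d → ℤ)‖ := by gcongr
      _ = _ := by ring
  · rw [← map_sub, (evol (-t)).norm_map, ← Finset.sum_sub_distrib, Finset.mul_sum]
    refine norm_sum_le_of_le _ fun l _ => ?_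
    rw [← sub_smul, ← mul_sub, norm_smul, norm_mul]
    have h1 : ‖expMap (ν l) t‖ = 1 := Complex.norm_exp_ofReal_mul_I _
    rw [h1, one_mul]
    gcongr
    exact hδ l t ht

theorem continuous_resonantControl {P : Type*} [TopologicalSpace P] (hT : 0 ≤ T)
    {K : Finset (Fin d → ℤ)} {W : P → (Fin d → ℤ) → C(ℝ, ℂ)} (hW : ∀ k, Continuous fun b => W b k)
    {r m : Fin d → ℤ} {θ : P → C(ℝ, ℝ)} (hθ : Continuous θ) {a a' : P → Fin 3 → C(ℝ, ℂ)}
    (ha : ∀ l, Continuous fun b => a b l) (ha' : ∀ l, Continuous fun b => a' b l) (ω : ℝ) (k : K) :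
    Continuous fun b => resonantControl T K (W b) r m (θ b) (a b) (a' b) ω k := by
  refine (continuous_toControl hT).comp ?_
  refine Continuous.add ((continuous_gaugeMap.comp hθ).mul (hW k))
    (continuous_finsetSum _ fun l _ => ?_)
  split_ifs
  · have h1 : ∀ c : ℂ, Continuous fun b => c • a b l := fun c => (ha l).const_smul c
    exact (continuous_const.mul ((ha' l).add (h1 _))).const_smul (-Complex.I)
  · exact continuous_const

variable {P : Type*} [TopologicalSpace P] [CompactSpace P] [FirstCountableTopology P]

/-- For smooth families whose control in the mode `2r - m` is of the form `(bump T)³ q`, the mode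
`2r - m` can be dispensed with: the controls `resonantControl` with one large frequency `ω` serve
all parameters. Their Duhamel terms depend on the parameter continuously, uniformly in `ω`; hence a
frequency that is large enough for a parameter `b₀` is so for all parameters near `b₀`. -/
theorem exists_control_near_of_eq_bump (hT : 0 < T) {K : Finset (Fin d → ℤ)}
    (u₀ : SobolevSpace d s) {r m : Fin d → ℤ} (hr : r ∈ K) (hm : m ∈ K) (hrm : 2 • r - m ∉ K)
    {W : P → (Fin d → ℤ) → C(ℝ, ℂ)} (hW : ∀ k, Continuous fun b => W b k)
    {q q' : P → C(ℝ, ℂ)} (hq : Continuous q) (hq' : Continuous q')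
    (hqd : ∀ b t, HasDerivAt (q b) (q' b t) t) (hWq : ∀ b, W b (2 • r - m) = bump T ^ 3 * q b)
    (hsol : ∀ b, ∃ u, IsMildSolution u₀
      (fun k : (K ∪ {2 • r - m} : Finset (Fin d → ℤ)) => toControl T (W b k)) u)
    {ε : ℝ} (hε : 0 < ε) :
    ∃ v : P → K → L1Control T, (∀ k, Continuous fun b => v b k) ∧ ∀ b, ∃ y z,
      IsEndPoint u₀ (fun k : (K ∪ {2 • r - m} : Finset (Fin d → ℤ)) => toControl T (W b k)) y ∧
      IsEndPoint u₀ (v b) z ∧ ‖z - y‖ ≤ ε := by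
  obtain ⟨θ, θ', a, a', hθ, ha, ha', h⟩ := exists_amplitudes hT hq hq' hqd
  have hκ : ∀ l, (![r, m, r] : Fin 3 → _) l ∈ K := by
    intro l
    fin_cases l
    · exact hr
    · exact hm
    · exact hr
  suffices hω : ∀ᶠ ω : ℝ in atTop, ∀ b ∈ (univ : Set P), ∃ y z,
      IsEndPoint u₀ (fun k : (K ∪ {2 • r - m} : Finset (Fin d → ℤ)) => toControl T (W b k)) y ∧
      IsEndPoint u₀ (resonantControl T K (W b) r m (θ b) (a b) (a' b) ω) z ∧ ‖z - y‖ ≤ ε by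
    obtain ⟨ω, hω⟩ := hω.exists
    exact ⟨fun b => resonantControl T K (W b) r m (θ b) (a b) (a' b) ω,
      fun k => continuous_resonantControl hT.le hW hθ ha ha' ω k, fun b => hω b (mem_univ b)⟩
  refine isCompact_univ.induction_on (p := fun S : Set P => ∀ᶠ ω : ℝ in atTop, ∀ b ∈ S, ∃ y z,
      IsEndPoint u₀ (fun k : (K ∪ {2 • r - m} : Finset (Fin d → ℤ)) => toControl T (W b k)) y ∧
      IsEndPoint u₀ (resonantControl T K (W b) r m (θ b) (a b) (a' b) ω) z ∧ ‖z - y‖ ≤ ε)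
    (by simp) ?_ ?_ ?_
  · exact fun S S' hS hω => hω.mono fun ω hb b hbS => hb b (hS hbS)
  · intro S S' hω hω'
    filter_upwards [hω, hω'] with ω h1 h2 b hb
    exact hb.elim (h1 b) (h2 b)
  intro b₀ _
  obtain ⟨u, hu⟩ := hsol b₀
  obtain ⟨hθd, hθ0, hθT, had, ha0, haT, hθ', hres⟩ := h b₀
  obtain ⟨η', hη', hy⟩ := hu.exists_isEndPoint_near hT.le (half_pos hε)
  have hu' := (isMildSolution_iff _ _ _).1 hu
  let α : ℝ → SobolevSpace d s := IccExtend hT.le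
    ((Icc 0 T).domRestrict fun t => evol (-t) (u t))
  have hα : Continuous α := Continuous.Icc_extend'
    (continuousOn_iff_continuous_domRestrict.1 (continuousOn_evol continuousOn_id.neg hu'.1))
  have hαu : ∀ t ∈ Icc 0 T, α t = evol (-t) (u t) := fun t ht => IccExtend_of_mem hT.le _ ht
  have hαe : ∀ t ∈ Icc 0 T, α t = u₀ + (Complex.I • ∫ τ in (0 : ℝ)..t,
      ∑ k ∈ K ∪ {2 • r - m}, (W b₀ k τ * phase (-τ) k) • mode d s k) +
        ∫ τ in (0 : ℝ)..t, drift τ (α τ) := fun t ht => by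
    rw [hαu t ht, hu'.2 t ht, duhamel_toControl _ u₀ (W b₀) ht]
    congr 1
    refine intervalIntegral.integral_congr fun τ hτ => ?_
    rw [uIcc_of_le ht.1] at hτ
    simp only [hαu τ ⟨hτ.1, hτ.2.trans ht.2⟩]
  -- The bound `R`, hence also `η`, does not depend on the frequency `ω`.
  obtain ⟨R, hR⟩ : ∃ R, ∀ t ∈ Icc 0 T,
      ‖‖α t‖ + ∑ l : Fin 3, ‖a b₀ l t‖ * ‖mode d s ((![r, m, r] : Fin 3 → _) l)‖‖ ≤ R :=
    isCompact_Icc.exists_bound_of_continuousOn (hα.norm.add (continuous_finsetSum _ fun l _ =>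
      (a b₀ l).continuous.norm.mul continuous_const)).continuousOn
  obtain ⟨η, hη, hz⟩ := exists_isEndPoint_near (d := d) (s := s) hT.le R (half_pos hε)
  let C := ∑ k : K, T * ‖mode d s (k : Fin d → ℤ)‖ +
    ∑ l, ‖mode d s ((![r, m, r] : Fin 3 → _) l)‖
  have hC : 0 ≤ C := by positivity
  let ρ := η / 2 / (C + 1)
  have hρ : 0 < ρ := by positivity
  have hρC : ρ * C ≤ η / 2 := by
    have e : ρ * C = η / 2 * (C / (C + 1)) := by
      simp only [ρ]
      ring
    rw [e]
    exact mul_le_of_le_one_right (half_pos hη).le ((div_le_one (by positivity)).2 (by linarith))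
  have hU1 : ∀ᶠ b in 𝓝 b₀, ∀ k : (K ∪ {2 • r - m} : Finset (Fin d → ℤ)),
      ‖toControl T (W b k) - toControl T (W b₀ k)‖ < η' := by
    refine eventually_all.2 fun k => ?_
    have h1 : ContinuousAt (fun b => ‖toControl T (W b k) - toControl T (W b₀ k)‖) b₀ :=
      ((((continuous_toControl hT.le).comp (hW k)).sub continuous_const).norm).continuousAt
    exact h1.eventually_lt_const (by simpa using hη')
  have hU2 : ∀ᶠ b in 𝓝 b₀, ∀ k ∈ K, ∀ t ∈ Icc 0 T,
      ‖(gaugeMap (θ b) * W b k) t - (gaugeMap (θ b₀) * W b₀ k) t‖ < ρ :=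
    (Finset.eventually_all K).2 fun k _ => eventually_forall_norm_sub_lt
      ((continuous_gaugeMap.comp hθ).mul (hW k)) b₀ T hρ
  have hU3 : ∀ᶠ b in 𝓝 b₀, ∀ l, ∀ t ∈ Icc 0 T, ‖a b l t - a b₀ l t‖ < ρ :=
    eventually_all.2 fun l => eventually_forall_norm_sub_lt (ha l) b₀ T hρ
  refine ⟨_, mem_nhdsWithin_of_mem_nhds (hU1.and (hU2.and hU3)), ?_⟩
  filter_upwards [eventually_norm_duhamel_resonantControl_sub_le hr hm hrm hα hαe hθd hθ0 had ha0
    hθ' (fun t => (hres t).trans (by rw [hWq])) (half_pos hη)] with ω hω b hb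
  obtain ⟨hb1, hb2, hb3⟩ := hb
  obtain ⟨-, -, -, had', ha0', -⟩ := h b
  obtain ⟨y, hy1, hy2⟩ := hy (fun k => toControl T (W b k)) fun k => (hb1 k).le
  have hfc : Continuous (fastCurve r m α (θ b₀) (a b₀) ω) := continuous_fastCurve r m hα _ _ ω
  obtain ⟨z, hz1, hz2⟩ := hz K u₀ (resonantControl T K (W b) r m (θ b) (a b) (a' b) ω)
    (fastCurve r m α (θ b₀) (a b₀) ω) (fun t => fastCurve r m α (θ b₀) (a b₀) ω t -
      ∫ τ in (0 : ℝ)..t, drift τ (fastCurve r m α (θ b₀) (a b₀) ω τ)) hfc.continuousOn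
    (fun t ht => (norm_fastCurve_le r m α _ _ ω t).trans ((le_abs_self _).trans (hR t ht)))
    (fun t _ => (sub_add_cancel _ _).symm) fun t ht => by
      have h1 := hω t ht
      have h2 := (norm_duhamel_fastControl_sub_le hT.le u₀ hκ (fun l => freq l.succ * ω) had' ha0'
        had ha0 (fun k hk t ht => (hb2 k hk t ht).le) (fun l t ht => (hb3 l t ht).le) ht).trans hρC
      have h3 := norm_add_le_of_le h2 h1
      rw [add_halves] at h3
      refine le_trans (le_of_eq ?_) h3
      congr 1
      exact (sub_add_sub_cancel _ _ _).symm
  refine ⟨y, z, hy1, hz1, ?_⟩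
  have hT' : T ∈ Icc 0 T := ⟨hT.le, le_rfl⟩
  -- The gauge factor is `1` at time `T` and the oscillating field vanishes there.
  have hend : evol T (fastCurve r m α (θ b₀) (a b₀) ω T) = u T := by
    have h0 : fastField s r m (a b₀) ω T = 0 := by
      simp [fastField, haT]
    rw [fastCurve, h0, map_zero, add_zero, hθT, one_smul, hαu T hT', evol_evol_neg]
  rw [hend] at hz2
  have h1 := norm_sub_le (z - u T) (y - u T)
  rw [sub_sub_sub_cancel_right] at h1
  linarith

end RemoveMode

/-! ### Approximation by smooth families of controls -/

section Density

variable {T : ℝ}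

theorem toControl_sum_smul {ι : Type*} (T : ℝ) (F : Finset ι) (c : ι → ℂ) (f : ι → C(ℝ, ℂ)) :
    toControl T (∑ x ∈ F, c x • f x) = ∑ x ∈ F, c x • toControl T (f x) := by
  let L : C(ℝ, ℂ) →ₗ[ℂ] L1Control T :=
    { toFun := toControl T
      map_add' := fun _ _ => rfl
      map_smul' := fun _ _ => rfl }
  change L _ = ∑ x ∈ F, c x • L (f x)
  simp

/-- A continuous control `g` is the limit in `L¹` of the controls `h³ q` with
`q = g / (h³ + 1/(n+1))` and `h` the bump. -/
theorem tendsto_toControl_bump (g : C(ℝ, ℂ)) {q : ℕ → C(ℝ, ℂ)}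
    (hq : ∀ n t, q n t = (((t * (T - t)) ^ 2) ^ 3 + 1 / (n + 1) : ℝ)⁻¹ * g t) :
    Tendsto (fun n => toControl T (bump T ^ 3 * q n)) atTop (𝓝 (toControl T g)) := by
  rw [tendsto_iff_norm_sub_tendsto_zero]
  have e : ∀ n, ‖toControl T (bump T ^ 3 * q n) - toControl T g‖ =
      ∫ t in Icc 0 T, ‖(bump T ^ 3 * q n) t - g t‖ := fun n => by
    rw [norm_toControl_sub]
    refine integral_congr_ae ?_
    filter_upwards [coeFn_toControl T (bump T ^ 3 * q n)] with t ht
    rw [ht]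
  simp only [e]
  -- The difference is `g` times the factor `(1/(n+1)) / (bump³ + 1/(n+1)) ∈ [0, 1]`.
  have e2 : ∀ (n : ℕ) t, (bump T ^ 3 * q n) t - g t =
      ((-(1 / (n + 1)) / (((t * (T - t)) ^ 2) ^ 3 + 1 / (n + 1)) : ℝ) : ℂ) * g t := fun n t => by
    have hpos : 0 < ((t * (T - t)) ^ 2) ^ 3 + 1 / ((n : ℝ) + 1) := by positivity
    have h1 : (bump T ^ 3 * q n) t = (((t * (T - t)) ^ 2 : ℝ) : ℂ) ^ 3 * q n t := rfl
    rw [h1, hq, ← mul_assoc, ← sub_one_mul]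
    congr 1
    norm_cast
    field_simp
    ring
  suffices h : Tendsto (fun n => ∫ t in Icc 0 T, ‖(bump T ^ 3 * q n) t - g t‖) atTop
      (𝓝 (∫ _t in Icc 0 T, (0 : ℝ))) by rwa [integral_zero] at h
  have hgi : IntegrableOn (fun t => ‖g t‖) (Icc 0 T) := g.continuous.norm.integrableOn_Icc
  refine tendsto_integral_of_dominated_convergence (fun t => ‖g t‖)
    (fun n => ((bump T ^ 3 * q n).continuous.sub g.continuous).norm.aestronglyMeasurable)
    hgi (fun n => Eventually.of_forall fun t => ?_) ?_
  · have hpos : 0 < ((t * (T - t)) ^ 2) ^ 3 + 1 / ((n : ℝ) + 1) := by positivity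
    rw [norm_norm, e2, norm_mul, Complex.norm_real, norm_div, norm_neg, Real.norm_of_nonneg hpos.le,
      Real.norm_of_nonneg (by positivity)]
    refine mul_le_of_le_one_left (norm_nonneg _) ((div_le_one hpos).2 ?_)
    have : 0 ≤ ((t * (T - t)) ^ 2) ^ 3 := by positivity
    linarith
  · have hne : ∀ᵐ t ∂(volume.restrict (Icc 0 T)), t ≠ 0 ∧ t ≠ T :=
      ae_restrict_of_ae ((Measure.ae_ne volume 0).and (Measure.ae_ne volume T))
    filter_upwards [hne] with t ht
    have hpos : ((t * (T - t)) ^ 2) ^ 3 ≠ 0 :=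
      pow_ne_zero _ (pow_ne_zero _ (mul_ne_zero ht.1 (sub_ne_zero.2 ht.2.symm)))
    have h1 := tendsto_one_div_add_atTop_nhds_zero_nat (𝕜 := ℝ)
    have h2 : Tendsto (fun n : ℕ =>
        -(1 / ((n : ℝ) + 1)) / (((t * (T - t)) ^ 2) ^ 3 + 1 / (n + 1))) atTop (𝓝 0) := by
      rw [show (0 : ℝ) = -0 / (((t * (T - t)) ^ 2) ^ 3 + 0) by simp]
      exact h1.neg.div (h1.const_add _) (by simpa using hpos)
    have h4 := ((Complex.continuous_ofReal.tendsto _).comp h2).mul_const (g t)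
    simp only [e2]
    simpa using h4.norm

/-- The controls `(bump T)³ q` with `q` continuously differentiable are dense in `L¹`. -/
theorem dense_toControl_bump (T : ℝ) :
    Dense {x : L1Control T | ∃ q q' : C(ℝ, ℂ), (∀ t, HasDerivAt q (q' t) t) ∧
      x = toControl T (bump T ^ 3 * q)} := by
  have hd := Lp.dense_hasCompactSupport_contDiff (E := ℝ) (F := ℂ) (p := 1)
    (μ := volume.restrict (Icc 0 T)) ENNReal.one_ne_top
  refine dense_iff_closure_eq.2 (eq_univ_of_univ_subset ?_)
  rw [← hd.closure_eq]
  refine closure_minimal ?_ isClosed_closure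
  rintro x ⟨g, hxg, -, hg⟩
  let G : C(ℝ, ℂ) := ⟨g, hg.continuous⟩
  have hx : x = toControl T G := Lp.ext (hxg.trans (coeFn_toControl T G).symm)
  have hcd : ∀ n : ℕ, ContDiff ℝ 1 fun t : ℝ =>
      (((((t * (T - t)) ^ 2) ^ 3 + 1 / (n + 1) : ℝ)⁻¹ : ℝ) : ℂ) * g t := fun n => by
    have h1 : ContDiff ℝ 1 fun t : ℝ => (((t * (T - t)) ^ 2) ^ 3 + 1 / (n + 1) : ℝ)⁻¹ :=
      ContDiff.inv (by fun_prop) fun t => by positivity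
    exact (Complex.ofRealCLM.contDiff.comp h1).mul (hg.of_le (by simp))
  let q : ℕ → C(ℝ, ℂ) := fun n => ⟨_, (hcd n).continuous⟩
  rw [hx]
  refine mem_closure_of_tendsto (tendsto_toControl_bump G (q := q) fun n t => ?_)
    (Eventually.of_forall fun n => ⟨q n, ⟨_, (hcd n).continuous_deriv le_rfl⟩, fun t =>
      ((hcd n).differentiable one_ne_zero t).hasDerivAt, rfl⟩)
  simp [q, G]

theorem exists_toControl_bump_approx {P : Type*} [TopologicalSpace P] [CompactSpace P]
    {f : P → L1Control T} (hf : Continuous f) {ε : ℝ} (hε : 0 < ε) :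
    ∃ q q' : P → C(ℝ, ℂ), Continuous q ∧ Continuous q' ∧ (∀ b t, HasDerivAt (q b) (q' b t) t) ∧
      ∀ b, ‖toControl T (bump T ^ 3 * q b) - f b‖ ≤ ε := by
  obtain ⟨F, φ, hF, hφ, hφf⟩ := exists_finset_sum_approx hf (dense_toControl_bump T) hε
  have hF' : ∀ x ∈ F, ∃ q q' : C(ℝ, ℂ), (∀ t, HasDerivAt q (q' t) t) ∧
    x = toControl T (bump T ^ 3 * q) := fun x hx => hF hx
  choose! q q' hq hqx using hF'
  have hc : ∀ p : L1Control T → C(ℝ, ℂ), Continuous fun b => ∑ x ∈ F, (φ x b : ℂ) • p x := fun p =>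
    continuous_finsetSum _ fun x _ => (Complex.continuous_ofReal.comp (hφ x)).smul continuous_const
  refine ⟨_, _, hc q, hc q', fun b t => ?_, fun b => ?_⟩
  · have h1 : HasDerivAt (fun t => ∑ x ∈ F, (φ x b : ℂ) * q x t)
        (∑ x ∈ F, (φ x b : ℂ) * q' x t) t :=
      HasDerivAt.fun_sum fun x hx => (hq x hx t).const_mul _
    convert h1 using 1
    · ext t
      simp [ContinuousMap.sum_apply]
    · simp [ContinuousMap.sum_apply]
  · have e : toControl T (bump T ^ 3 * ∑ x ∈ F, (φ x b : ℂ) • q x) = ∑ x ∈ F, (φ x b : ℂ) • x := by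
      simp only [Finset.mul_sum, mul_smul_comm]
      rw [toControl_sum_smul]
      exact Finset.sum_congr rfl fun x hx => by rw [← hqx x hx]
    rw [e]
    exact hφf b

end Density

/-! ### Proper extensions -/

section ProperExtension

variable {d : ℕ} {s : ℝ} {T : ℝ} [Fact ((d : ℝ) / 2 < s)]
variable {P : Type*} [TopologicalSpace P] [CompactSpace P]

theorem exists_control_near_of_dense (hT : 0 < T) {u₀ : SobolevSpace d s}
    {K : Finset (Fin d → ℤ)} {X : Submodule ℂ (L1Control T)} (hX : Dense (X : Set (L1Control T)))
    {w : P → K → L1Control T} (hw : ∀ k, Continuous fun b => w b k)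
    (hsol : ∀ b, ∃ u, IsMildSolution u₀ (w b) u) {ε : ℝ} (hε : 0 < ε) :
    ∃ v : P → K → L1Control T, (∀ k, Continuous fun b => v b k) ∧ (∀ b k, v b k ∈ X) ∧ ∀ b, ∃ y z,
      IsEndPoint u₀ (w b) y ∧ IsEndPoint u₀ (v b) z ∧ ‖z - y‖ ≤ ε := by
  obtain ⟨η, hη, hnear⟩ := exists_forall_isEndPoint_near hT.le hw hsol hε
  choose F φ hF hφ hφw using fun k => exists_finset_sum_approx (hw k) hX hη
  exact ⟨fun b k => ∑ x ∈ F k, (φ k x b : ℂ) • x,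
    fun k => continuous_finsetSum _ fun x _ =>
      (Complex.continuous_ofReal.comp (hφ k x)).smul continuous_const,
    fun b k => X.sum_mem fun x hx => X.smul_mem _ (hF k hx), fun b => hnear b _ fun k => hφw k b⟩

variable [FirstCountableTopology P]

/-- Controls in the modes of an elementary extension can be replaced by controls in the original
modes: approximate them by smooth families and remove the added mode. -/
theorem exists_control_near_of_isElementaryExtension (hT : 0 < T) {u₀ : SobolevSpace d s}
    {K K' : Finset (Fin d → ℤ)} (h : IsElementaryExtension K K') {w : P → K' → L1Control T}
    (hw : ∀ k, Continuous fun b => w b k) (hsol : ∀ b, ∃ u, IsMildSolution u₀ (w b) u)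
    {ε : ℝ} (hε : 0 < ε) :
    ∃ v : P → K → L1Control T, (∀ k, Continuous fun b => v b k) ∧ ∀ b, ∃ y z,
      IsEndPoint u₀ (w b) y ∧ IsEndPoint u₀ (v b) z ∧ ‖z - y‖ ≤ ε := by
  obtain ⟨r, hr, m, hm, hK'⟩ := h
  by_cases hrm : 2 • r - m ∈ K
  · rw [Finset.union_eq_left.2 (Finset.singleton_subset_iff.2 hrm)] at hK'
    subst hK'
    refine ⟨w, hw, fun b => ?_⟩
    obtain ⟨u, hu⟩ := hsol b
    exact ⟨_, _, hu.isEndPoint, hu.isEndPoint, by simpa using hε.le⟩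
  subst hK'
  obtain ⟨η, hη, hnear⟩ := exists_forall_isEndPoint_near hT.le hw hsol (half_pos hε)
  choose q q' hq hq' hqd hqw using fun k => exists_toControl_bump_approx (hw k) hη
  let W : P → (Fin d → ℤ) → C(ℝ, ℂ) := fun b k =>
    if hk : k ∈ K ∪ {2 • r - m} then bump T ^ 3 * q ⟨k, hk⟩ b else 0
  have hWk : ∀ b (k : (K ∪ {2 • r - m} : Finset (Fin d → ℤ))), W b k = bump T ^ 3 * q k b :=
    fun b k => dif_pos k.2
  have hW : ∀ k, Continuous fun b => W b k := fun k => by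
    by_cases hk : k ∈ K ∪ {2 • r - m}
    · simp only [W, dif_pos hk]
      exact continuous_const.mul (hq _)
    · simp only [W, dif_neg hk]
      exact continuous_const
  have hn := fun b => hnear b (fun k => toControl T (W b k)) fun k => by
    rw [hWk]
    exact hqw k b
  have hmem : 2 • r - m ∈ K ∪ {2 • r - m} := Finset.mem_union_right _ (Finset.mem_singleton_self _)
  obtain ⟨v, hv, hvz⟩ := exists_control_near_of_eq_bump hT u₀ hr hm hrm hW
    (hq ⟨_, hmem⟩) (hq' ⟨_, hmem⟩) (hqd ⟨_, hmem⟩) (fun b => hWk b ⟨_, hmem⟩)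
    (fun b => by
      obtain ⟨_, _, -, ⟨u, hu, -⟩, -⟩ := hn b
      exact ⟨u, hu⟩) (half_pos hε)
  refine ⟨v, hv, fun b => ?_⟩
  obtain ⟨y, x, hy, hx, hxy⟩ := hn b
  obtain ⟨x', z, hx', hz, hzx⟩ := hvz b
  obtain rfl := hx.unique hT.le hx'
  refine ⟨y, z, hy, hz, ?_⟩
  have h1 := norm_add_le_of_le hzx hxy
  rwa [sub_add_sub_cancel, add_halves] at h1

theorem exists_control_near_of_isProperExtension (hT : 0 < T) {u₀ : SobolevSpace d s}
    {Khat K : Finset (Fin d → ℤ)} (h : IsProperExtension Khat K) {w : P → K → L1Control T}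
    (hw : ∀ k, Continuous fun b => w b k) (hsol : ∀ b, ∃ u, IsMildSolution u₀ (w b) u)
    {ε : ℝ} (hε : 0 < ε) :
    ∃ v : P → Khat → L1Control T, (∀ k, Continuous fun b => v b k) ∧ ∀ b, ∃ y z,
      IsEndPoint u₀ (w b) y ∧ IsEndPoint u₀ (v b) z ∧ ‖z - y‖ ≤ ε := by
  induction h using Relation.ReflTransGen.head_induction_on generalizing ε with
  | refl =>
    refine ⟨w, hw, fun b => ?_⟩
    obtain ⟨u, hu⟩ := hsol b
    exact ⟨_, _, hu.isEndPoint, hu.isEndPoint, by simpa using hε.le⟩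
  | head h' _ ih =>
    obtain ⟨v', hv', hvx⟩ := ih (half_pos hε)
    obtain ⟨v, hv, hvz⟩ := exists_control_near_of_isElementaryExtension hT h' hv'
      (fun b => by
        obtain ⟨_, _, -, ⟨u, hu, -⟩, -⟩ := hvx b
        exact ⟨u, hu⟩) (half_pos hε)
    refine ⟨v, hv, fun b => ?_⟩
    obtain ⟨y, x, hy, hx, hxy⟩ := hvx b
    obtain ⟨x', z, hx', hz, hzx⟩ := hvz b
    obtain rfl := hx.unique hT.le hx'
    refine ⟨y, z, hy, hz, ?_⟩
    have h1 := norm_add_le_of_le hzx hxy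
    rwa [sub_add_sub_cancel, add_halves] at h1

end ProperExtension

end TorusNLS

end

theorem mainTheorem4 (d : ℕ) (hd : 1 ≤ d) (s : ℝ) (hs : (d : ℝ) / 2 < s) (T : ℝ) (hT : 0 < T)
    (u₀ : TorusNLS.SobolevSpace d s)
    (Khat K : Finset (Fin d → ℤ)) (hK : TorusNLS.IsProperExtension Khat K)
    (X : Submodule ℂ (TorusNLS.L1Control T)) (hX : Dense (X : Set (TorusNLS.L1Control T)))
    (N : ℕ) (B : Set (EuclideanSpace ℝ (Fin N))) (hB : IsCompact B)
    (w : EuclideanSpace ℝ (Fin N) → K → TorusNLS.L1Control T)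
    (hw : ∀ k : K, ContinuousOn (fun b => w b k) B)
    (hsol : ∀ b ∈ B, ∃ u, TorusNLS.IsMildSolution u₀ (w b) u)
    (δ : ℝ) (hδ : 0 < δ) :
    ∃ v : EuclideanSpace ℝ (Fin N) → Khat → TorusNLS.L1Control T,
      (∀ k : Khat, ContinuousOn (fun b => v b k) B) ∧
      (∀ b ∈ B, ∀ k : Khat, v b k ∈ X) ∧
      ∀ b ∈ B, ∃ y z : TorusNLS.SobolevSpace d s,
        TorusNLS.IsEndPoint u₀ (w b) y ∧ TorusNLS.IsEndPoint u₀ (v b) z ∧ ‖z - y‖ ≤ δ := by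
  have : Fact ((d : ℝ) / 2 < s) := ⟨hs⟩
  have : CompactSpace B := isCompact_iff_compactSpace.1 hB
  obtain ⟨v₁, hv₁, hx⟩ := TorusNLS.exists_control_near_of_isProperExtension (P := B) hT hK
    (w := fun b => w b) (fun k => continuousOn_iff_continuous_domRestrict.1 (hw k))
    (fun b => hsol b b.2) (half_pos hδ)
  obtain ⟨v, hv, hvX, hz⟩ := TorusNLS.exists_control_near_of_dense hT hX hv₁
    (fun b => by
      obtain ⟨_, _, -, ⟨u, hu, -⟩, -⟩ := hx b
      exact ⟨u, hu⟩) (half_pos hδ)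
  classical
  have e : ∀ b : B, (fun b => if hb : b ∈ B then v ⟨b, hb⟩ else 0 :
      EuclideanSpace ℝ (Fin N) → Khat → TorusNLS.L1Control T) b = v b := fun b => dif_pos b.2
  refine ⟨fun b => if hb : b ∈ B then v ⟨b, hb⟩ else 0, fun k => ?_, fun b hb k => ?_,
    fun b hb => ?_⟩
  · rw [continuousOn_iff_continuous_domRestrict]
    refine (hv k).congr fun b => ?_
    exact (congrFun (e b) k).symm
  · simp only [dif_pos hb]
    exact hvX _ k
  · simp only [dif_pos hb]
    obtain ⟨y, x, hy, hx, hxy⟩ := hx ⟨b, hb⟩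
    obtain ⟨x', z, hx', hz, hzx⟩ := hz ⟨b, hb⟩
    obtain rfl := hx.unique hT.le hx'
    refine ⟨y, z, hy, hz, ?_⟩
    have h1 := norm_add_le_of_le hzx hxy
    rwa [sub_add_sub_cancel, add_halves] at h1
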